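/- Let $k\ge 1$ be an integer. There is a constant $c=c(k)>0$ such that for all reals $\varepsilon,d\in(0,c)$ there is an $n_0=n_0(\varepsilon,d,k)$ for which the following holds. Let $G$ be a finite simple graph of order $n\ge n_0$ and let $n_1,\dots,n_k$ be positive integers with $n_1+\dots+n_k=n$. Assume that $\sigma_2(G)\ge n+k-1$, where $\sigma_2(G)$ is the minimum of $\deg(u)+\deg(v)$ over all pairs of distinct nonadjacent vertices ($+\infty$ if $G$ is complete), and that the minimum degree satisfies $\delta(G)\ge \frac18\max_i n_i$. Let $V(G)=V_0\cup V_1\cup\dots\cup V_r$ be any partition and $G'\subseteq G$ any spanning subgraph as given by the Regularity Lemma, that is, for some integers $m,M$: (1) $m\le r\le M$; (2) $|V_0|\le\varepsilon n$; (3) $|V_1|=\dots=|V_r|=L\le\varepsilon n$; (4) $\deg_{G'}(v)>\deg_G(v)-(d+\varepsilon)n$ for all $v\in V(G)$; (5) $G'$ has no edge inside $V_i$ for $i\ge1$; (6) for $1\le i<j\le r$ the pair $(V_i,V_j)$ is $\varepsilon$-regular in $G'$ and its density in $G'$ is either $0$ or greater than $d$. Here the density of a pair of disjoint nonempty sets is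 $d(A,B)=e(A,B)/(|A||B|)$, and $(A,B)$ is $\varepsilon$-regular if $A,B$ are nonempty and disjoint and $|d(X,Y)-d(A,B)|<\varepsilon$ for all $X\subseteq A$, $Y\subseteq B$ with $|X|>\varepsilon|A|$ and $|Y|>\varepsilon|B|$. Let $R$ be the reduced graph on $\{1,\dots,r\}$, in which distinct $i,j$ are adjacent if and only if the density of $(V_i,V_j)$ in $G'$ is greater than $d$, and let $\kappa(R)$ be its vertex connectivity (the least number of vertices whose deletion leaves a disconnected graph or at most one vertex). If $\kappa(R)\le\varepsilon|R|$ or $\kappa(R)\le 1$, then for any $k$ distinct vertices $x_1,\dots,x_k$ of $G$ there are pairwise vertex-disjoint paths $P_1,\dots,P_k$ in $G$ such that, for every $i$, $P_i$ starts at $x_i$ and has exactly $n_i$ vertices. -/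

import Mathlib

universe u

/-- The minimum degree sum `σ₂(G)` over pairs of distinct nonadjacent vertices
(`⊤` when there is no such pair, that is, when `G` is complete). -/
noncomputable def sigmaTwo {V : Type*} [Fintype V] (G : SimpleGraph V) [DecidableRel G.Adj] :
    ℕ∞ :=
  ⨅ (u : V) (v : V) (_ : u ≠ v) (_ : ¬ G.Adj u v), ((G.degree u + G.degree v : ℕ) : ℕ∞)

/-- The (vertex) connectivity `κ(G)`: the least number of vertices whose deletion leaves a
disconnected graph or a graph with at most one vertex. Thus `κ(K_r) = r - 1`, and for a
noncomplete graph it is the least size of a vertex cut. -/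
noncomputable def vertexConnectivity {V : Type*} [Fintype V] (G : SimpleGraph V) : ℕ :=
  sInf {c : ℕ | ∃ S : Finset V, S.card = c ∧
    (¬ (G.induce {v | v ∉ S}).Connected ∨ Fintype.card V ≤ S.card + 1)}

/-- `(A, B)` is an `ε`-regular pair of `G`: `A`, `B` are nonempty and disjoint, and
`|d(X, Y) - d(A, B)| < ε` for all `X ⊆ A`, `Y ⊆ B` with `|X| > ε|A|` and `|Y| > ε|B|`. -/
def IsRegularPair {V : Type*} [DecidableEq V] (G : SimpleGraph V) [DecidableRel G.Adj]
    (ε : ℝ) (A B : Finset V) : Prop :=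
  A.Nonempty ∧ B.Nonempty ∧ Disjoint A B ∧
    ∀ X ⊆ A, ∀ Y ⊆ B, ε * (A.card : ℝ) < (X.card : ℝ) → ε * (B.card : ℝ) < (Y.card : ℝ) →
      |((G.edgeDensity X Y : ℚ) : ℝ) - ((G.edgeDensity A B : ℚ) : ℝ)| < ε

/-- A partition of `V(G)` into a garbage set `V₀` and `r` clusters `C 0, …, C (r - 1)`, together
with a spanning subgraph `G'` of `G`, having all the properties which the (degree form of the)
Regularity Lemma provides for the parameters `ε`, `d` and the bounds `m ≤ r ≤ M`. -/
structure IsRegularityPartition {V : Type*} [Fintype V] [DecidableEq V]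
    (G G' : SimpleGraph V) [DecidableRel G.Adj] [DecidableRel G'.Adj]
    (ε d : ℝ) (m M r L : ℕ) (V₀ : Finset V) (C : Fin r → Finset V) : Prop where
  subgraph : G' ≤ G
  disjoint_clusters : ∀ i j, i ≠ j → Disjoint (C i) (C j)
  disjoint_garbage : ∀ i, Disjoint V₀ (C i)
  cover : ∀ v : V, v ∈ V₀ ∨ ∃ i, v ∈ C i
  lower : m ≤ r
  upper : r ≤ M
  card_garbage : (V₀.card : ℝ) ≤ ε * (Fintype.card V : ℝ)
  card_cluster : ∀ i, (C i).card = L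
  cluster_le : (L : ℝ) ≤ ε * (Fintype.card V : ℝ)
  degree_lt : ∀ v, (G.degree v : ℝ) - (d + ε) * (Fintype.card V : ℝ) < (G'.degree v : ℝ)
  cluster_indep : ∀ i, ∀ u ∈ C i, ∀ v ∈ C i, ¬ G'.Adj u v
  regular : ∀ i j, i < j → IsRegularPair G' ε (C i) (C j)
  density : ∀ i j, i < j → G'.edgeDensity (C i) (C j) = 0 ∨
    d < ((G'.edgeDensity (C i) (C j) : ℚ) : ℝ)

/-- The reduced graph: one vertex for each cluster, two of them joined when the density of
the corresponding pair of clusters in `G'` exceeds `d`. -/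
def reducedGraph {V : Type*} (G' : SimpleGraph V) [DecidableRel G'.Adj] (d : ℝ)
    {r : ℕ} (C : Fin r → Finset V) : SimpleGraph (Fin r) where
  Adj i j := i ≠ j ∧ d < ((G'.edgeDensity (C i) (C j) : ℚ) : ℝ)
  symm := ⟨fun i j h => ⟨h.1.symm, by rw [G'.edgeDensity_comm]; exact h.2⟩⟩
  loopless := ⟨fun _ h => h.1 rfl⟩

/-- There are pairwise vertex-disjoint paths `P i` in `G`, where `P i` starts at `x i` and has
exactly `s i` vertices. -/
def HasPrescribedPaths {V : Type*} (G : SimpleGraph V) {k : ℕ} (s : Fin k → ℕ)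
    (x : Fin k → V) : Prop :=
  ∃ (y : Fin k → V) (P : ∀ i, G.Walk (x i) (y i)),
    (∀ i, (P i).IsPath) ∧ (∀ i, (P i).support.length = s i) ∧
      ∀ i j, i ≠ j → List.Disjoint (P i).support (P j).support

/-!
A small cut of the reduced graph leaves clusters that fall into two families without edges of the
regularity subgraph between them, so all but few vertices of `G` lie in two sets `X` and `Y` with
almost no edges of `G` between them (`IsRegularityPartition.exists_no_edges`). The minimum degree
makes both sets linear in size. Hence every `u ∈ X` has a non-neighbour in `Y`, and as the degree
of the latter is hardly more than `#Y`, the degree sum condition forces `u` to be adjacent to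
almost all of `X`: both sets are nearly complete (`le_card_filter_adj_of_no_edges`). Each remaining
vertex joins a side in which it has many neighbours. Thus `V(G)` is the disjoint union of two sides
`A` and `B` of the type `NearSide`.

*Within a side.* A side can be partitioned into a bounded number of paths with prescribed starts
and numbers of vertices, and for some of them prescribed ends (`NearSide.exists_disjoint_paths`).
The longest of these paths first collects the exceptional vertices; all others are chosen greedily
in the nearly complete set that is left, and the longest one is completed to a Hamiltonian path of
the rest by inserting vertices between consecutive neighbours.

*Between the sides.* For nonadjacent `u ∈ A` and `v ∈ B` the numbers of neighbours across add up to
at least `k + 1`, and this gives `k + 1` disjoint edges between `A` and `B`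
(`hasMatchingBetween_of_degree_add`): one for every path and one to spare.

*Distribution.* Suppose that the paths starting in `A` have at least `#A` vertices in total. Those
with fewer than ten vertices stay in `A`. Of the others, some move to `B` as early as they can, and
one more moves to `B` after a suitable number of vertices, such that `A` is filled exactly
(`exists_paths_of_card_le`). The spare edge serves this last path when its start lies on its own
edge and it cannot cross there for good: the spare edge is the exit if the path has at least five
vertices in `A`; if it has two to four, the path leaves `A` immediately and returns through the
spare edge.
-/

/-! ### Paths as lists of vertices -/

/-- `l` lists the vertices of a path of `G` that starts at `s`, has exactly `n` vertices and,
if `t = some v`, ends at `v`; for `t = none` the end is free. -/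
structure IsPathList {V : Type*} (G : SimpleGraph V) (l : List V) (s : V) (t : Option V)
    (n : ℕ) : Prop where
  chain : l.IsChain G.Adj
  nodup : l.Nodup
  length : l.length = n
  head : l.head? = some s
  last : ∀ v ∈ t, l.getLast? = some v

section Dense

variable {V : Type*} {G : SimpleGraph V}

lemma isPathList_singleton (s : V) : IsPathList G [s] s none 1 :=
  ⟨by simp, by simp, rfl, rfl, by simp⟩

lemma IsPathList.mem_start {l : List V} {s : V} {t : Option V} {n : ℕ}
    (h : IsPathList G l s t n) : s ∈ l :=
  List.mem_of_mem_head? (by rw [h.head]; rfl)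

lemma IsPathList.ne_nil {l : List V} {s : V} {t : Option V} {n : ℕ}
    (h : IsPathList G l s t n) : l ≠ [] :=
  List.ne_nil_of_mem h.mem_start

lemma IsPathList.append {l l' : List V} {s a b : V} {t : Option V} {n m : ℕ}
    (h : IsPathList G l s (some a) n) (h' : IsPathList G l' b t m) (hab : G.Adj a b)
    (hd : l.Disjoint l') : IsPathList G (l ++ l') s t (n + m) := by
  refine ⟨?_, ?_, ?_, ?_, ?_⟩
  · rw [List.isChain_append]
    refine ⟨h.chain, h'.chain, ?_⟩
    intro x hx y hy
    rw [h.last a rfl] at hx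
    rw [h'.head] at hy
    simp only [Option.mem_def, Option.some.injEq] at hx hy
    subst hx hy
    exact hab
  · exact List.nodup_append.2 ⟨h.nodup, h'.nodup, fun x hx y hy hxy => hd hx (hxy ▸ hy)⟩
  · simp [h.length, h'.length]
  · rw [List.head?_append, h.head]; rfl
  · intro v hv
    rw [List.getLast?_append, h'.last v hv]; rfl

lemma IsPathList.cons {l : List V} {a b : V} {t : Option V} {n : ℕ}
    (h : IsPathList G l b t n) (hab : G.Adj a b) (ha : a ∉ l) :
    IsPathList G (a :: l) a t (n + 1) := by
  have := IsPathList.append (l := [a]) (n := 1) (s := a) (a := a)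
    ⟨by simp, by simp, rfl, rfl, by simp⟩ h hab (by simpa using ha)
  rwa [add_comm] at this

lemma IsPathList.concat {l : List V} {s a b : V} {n : ℕ}
    (h : IsPathList G l s (some a) n) (hab : G.Adj a b) (hb : b ∉ l) :
    IsPathList G (l ++ [b]) s (some b) (n + 1) :=
  h.append (l' := [b]) (b := b) ⟨by simp, by simp, rfl, rfl, by simp⟩ hab (by simpa using hb)

/-- Either two consecutive entries of a list satisfy `p`, or at most about half of the
entries do. -/
lemma exists_consecutive_or_length_le (p : V → Prop) [DecidablePred p] (l : List V) :
    (∃ l₁ a b l₂, l = l₁ ++ a :: b :: l₂ ∧ p a ∧ p b) ∨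
      l.length ≤ 2 * l.countP (fun v => ¬ p v) + 1 := by
  induction hn : l.length using Nat.strong_induction_on generalizing l with
  | _ n ih =>
    subst hn
    match l with
    | [] => right; simp
    | [a] => right; simp
    | a :: b :: l =>
      by_cases ha : p a
      · by_cases hb : p b
        · exact Or.inl ⟨[], a, b, l, rfl, ha, hb⟩
        · rcases ih l.length (by simp) l rfl with ⟨l₁, c, d, l₂, h, hc, hd⟩ | h
          · exact Or.inl ⟨a :: b :: l₁, c, d, l₂, by simp [h], hc, hd⟩
          · right
            simp only [List.length_cons, List.countP_cons, ha, hb, not_true_eq_false,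
              not_false_eq_true, decide_true, decide_false, if_true]
            simp only [Bool.false_eq_true, if_false]
            omega
      · rcases ih (b :: l).length (by simp) (b :: l) rfl with ⟨l₁, c, d, l₂, h, hc, hd⟩ | h
        · exact Or.inl ⟨a :: l₁, c, d, l₂, by simp [h], hc, hd⟩
        · right
          rw [List.countP_cons]
          simp only [List.length_cons, ha, not_false_eq_true, decide_true, if_true] at h ⊢
          omega

/-- A vertex with few non-neighbours on a long path can be inserted into it between two
consecutive neighbours, which keeps both ends of the path. -/
lemma IsPathList.exists_insert [DecidableRel G.Adj] {l : List V} {s : V} {t : Option V} {n : ℕ}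
    (h : IsPathList G l s t n) {v : V} (hv : v ∉ l)
    (hn : 2 * l.countP (fun u => ¬ G.Adj v u) + 1 < n) :
    ∃ l', IsPathList G l' s t (n + 1) ∧ ∀ u ∈ l', u = v ∨ u ∈ l := by
  rcases exists_consecutive_or_length_le (fun u => G.Adj v u) l with ⟨l₁, a, b, l₂, e, ha, hb⟩ | h'
  · refine ⟨l₁ ++ a :: v :: b :: l₂, ⟨?_, ?_, ?_, ?_, ?_⟩, ?_⟩
    · have := h.chain
      rw [e, List.isChain_append_cons_cons] at this
      rw [List.isChain_append_cons_cons, List.isChain_cons_cons]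
      exact ⟨this.1, ha.symm, hb, this.2.2⟩
    · have hp : (l₁ ++ a :: v :: b :: l₂).Perm (v :: l) := by
        rw [e]
        have := List.perm_middle (a := v) (l₁ := l₁ ++ [a]) (l₂ := b :: l₂)
        simpa using this
      exact hp.nodup_iff.2 (List.nodup_cons.2 ⟨hv, h.nodup⟩)
    · rw [← h.length, e]; simp; omega
    · rw [← h.head, e]; cases l₁ <;> simp
    · intro w hw
      rw [← h.last w hw, e]
      simp [List.getLast?_append, List.getLast?_cons]
    · intro u hu
      rw [e]
      simp at hu ⊢
      tauto
  · rw [h.length] at h'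
    omega

/-! ### Paths in nearly complete vertex sets -/

/-- Every vertex of `T` has at most `g` non-neighbours in `T` (itself included). -/
def NearlyComplete (G : SimpleGraph V) [DecidableRel G.Adj] (T : Finset V) (g : ℕ) : Prop :=
  ∀ v ∈ T, (T.filter fun u => ¬ G.Adj v u).card ≤ g

lemma NearlyComplete.mono [DecidableRel G.Adj] {T T' : Finset V} {g : ℕ} (h : NearlyComplete G T g)
    (hT : T' ⊆ T) :
    NearlyComplete G T' g := fun v hv =>
  (Finset.card_le_card (Finset.filter_subset_filter _ hT)).trans (h v (hT hv))

variable [DecidableEq V] [DecidableRel G.Adj]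

lemma NearlyComplete.exists_common_adj {T : Finset V} {g : ℕ} (h : NearlyComplete G T g)
    {u v : V} (hu : u ∈ T) (hv : v ∈ T) {F : Finset V} (hF : F.card + 2 * g < T.card) :
    ∃ w ∈ T, w ∉ F ∧ G.Adj u w ∧ G.Adj v w := by
  by_contra! hc
  have : T ⊆ F ∪ (T.filter fun w => ¬ G.Adj u w) ∪ (T.filter fun w => ¬ G.Adj v w) := by
    intro w hw
    simp only [Finset.mem_union, Finset.mem_filter]
    have := hc w hw
    tauto
  have := Finset.card_le_card this
  have h1 := Finset.card_union_le (F ∪ (T.filter fun w => ¬ G.Adj u w))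
    (T.filter fun w => ¬ G.Adj v w)
  have h2 := Finset.card_union_le F (T.filter fun w => ¬ G.Adj u w)
  have := h u hu
  have := h v hv
  omega

lemma NearlyComplete.exists_path_closed {T : Finset V} {g : ℕ} (h : NearlyComplete G T g)
    {t : V} (ht : t ∈ T) {n : ℕ} (hn : 3 ≤ n) : ∀ {s : V}, s ∈ T → s ≠ t →
    ∀ {F : Finset V}, F.card + n + 2 * g ≤ T.card →
    ∃ l, IsPathList G l s (some t) n ∧ ∀ v ∈ l, v ∈ T ∧ (v = s ∨ v = t ∨ v ∉ F) := by
  induction n, hn using Nat.le_induction with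
  | base =>
    intro s hs hst F hF
    obtain ⟨w, hw, hwF, h1, h2⟩ := h.exists_common_adj hs ht (F := F) (by omega)
    refine ⟨[s, w, t], ⟨?_, ?_, rfl, rfl, by simp⟩, ?_⟩
    · simp [h1, h2.symm]
    · simp [h1.ne, h2.ne.symm, hst]
    · simp [hs, hw, ht, hwF]
  | succ n hn ih =>
    intro s hs hst F hF
    have hcard : (insert t F).card ≤ F.card + 1 := Finset.card_insert_le _ _
    have hcard' : (insert s F).card ≤ F.card + 1 := Finset.card_insert_le _ _
    obtain ⟨w, hw, hwF, h1, -⟩ := h.exists_common_adj hs hs (F := insert t F) (by omega)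
    simp only [Finset.mem_insert, not_or] at hwF
    obtain ⟨l, hl, hl'⟩ := ih hw hwF.1 (F := insert s F) (by omega)
    refine ⟨s :: l, hl.cons h1 ?_, ?_⟩
    · intro hsl
      have := (hl' s hsl).2
      simp [h1.ne, hst] at this
    · intro v hv
      rcases List.mem_cons.1 hv with rfl | hv
      · simp [hs]
      · refine ⟨(hl' v hv).1, ?_⟩
        rcases (hl' v hv).2 with rfl | rfl | h3
        · exact Or.inr (Or.inr hwF.2)
        · simp
        · simp only [Finset.mem_insert, not_or] at h3
          exact Or.inr (Or.inr h3.2)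

lemma NearlyComplete.exists_path_open {T : Finset V} {g : ℕ} (h : NearlyComplete G T g)
    {n : ℕ} (hn : 1 ≤ n) : ∀ {s : V}, s ∈ T →
    ∀ {F : Finset V}, F.card + n + 2 * g ≤ T.card →
    ∃ l, IsPathList G l s none n ∧ ∀ v ∈ l, v ∈ T ∧ (v = s ∨ v ∉ F) := by
  induction n, hn using Nat.le_induction with
  | base =>
    intro s hs F hF
    exact ⟨[s], isPathList_singleton s, by simp [hs]⟩
  | succ n hn ih =>
    intro s hs F hF
    have hcard' : (insert s F).card ≤ F.card + 1 := Finset.card_insert_le _ _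
    obtain ⟨w, hw, hwF, h1, -⟩ := h.exists_common_adj hs hs (F := F) (by omega)
    obtain ⟨l, hl, hl'⟩ := ih hw (F := insert s F) (by omega)
    refine ⟨s :: l, hl.cons h1 ?_, ?_⟩
    · intro hsl
      have := (hl' s hsl).2
      simp [h1.ne] at this
    · intro v hv
      rcases List.mem_cons.1 hv with rfl | hv
      · simp [hs]
      · refine ⟨(hl' v hv).1, ?_⟩
        rcases (hl' v hv).2 with rfl | h3
        · exact Or.inr hwF
        · simp only [Finset.mem_insert, not_or] at h3
          exact Or.inr h3.2

/-- A path in a nearly complete set whose start and, possibly, end are prescribed and which avoids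
`F` otherwise. A path between two given vertices needs a third vertex, as these vertices need not
be adjacent. -/
lemma NearlyComplete.exists_path {T : Finset V} {g : ℕ} (h : NearlyComplete G T g)
    {n : ℕ} (hn : 1 ≤ n) {s : V} (hs : s ∈ T) {t : Option V}
    (ht : ∀ v ∈ t, v ∈ T ∧ s ≠ v ∧ 3 ≤ n)
    {F : Finset V} (hF : F.card + n + 2 * g ≤ T.card) :
    ∃ l, IsPathList G l s t n ∧ ∀ v ∈ l, v ∈ T ∧ (v = s ∨ t = some v ∨ v ∉ F) := by
  cases t with
  | none =>
    obtain ⟨l, hl, hl'⟩ := h.exists_path_open hn hs hF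
    exact ⟨l, hl, fun v hv => ⟨(hl' v hv).1, by have := (hl' v hv).2; tauto⟩⟩
  | some t =>
    obtain ⟨h1, h2, h3⟩ := ht t rfl
    obtain ⟨l, hl, hl'⟩ := h.exists_path_closed h1 h3 hs h2 hF
    refine ⟨l, hl, fun v hv => ⟨(hl' v hv).1, ?_⟩⟩
    rcases (hl' v hv).2 with h | h | h <;> simp [h]

/-- A large nearly complete set is Hamilton-connected. -/
lemma NearlyComplete.exists_hamiltonian_path {W : Finset V} {g : ℕ} (h : NearlyComplete G W g)
    (hW : 4 * g + 5 ≤ W.card) {s : V} (hs : s ∈ W) {t : Option V} (ht : ∀ v ∈ t, v ∈ W ∧ s ≠ v) :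
    ∃ l, IsPathList G l s t W.card ∧ ∀ v ∈ l, v ∈ W := by
  have key : ∀ m, 2 * g + 3 ≤ m → m ≤ W.card →
      ∃ l, IsPathList G l s t m ∧ ∀ v ∈ l, v ∈ W := by
    intro m hm
    induction m, hm using Nat.le_induction with
    | base =>
      intro _
      obtain ⟨l, hl, hl'⟩ := h.exists_path (n := 2 * g + 3) (by omega) hs (t := t) (F := ∅)
        (fun v hv => ⟨(ht v hv).1, (ht v hv).2, by omega⟩) (by simp; omega)
      exact ⟨l, hl, fun v hv => (hl' v hv).1⟩
    | succ m hm ih =>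
      intro hmW
      obtain ⟨l, hl, hl'⟩ := ih (by omega)
      have hcard : l.toFinset.card = m := by
        rw [List.toFinset_card_of_nodup hl.nodup, hl.length]
      obtain ⟨v, hvW, hvl⟩ := Finset.exists_mem_notMem_of_card_lt_card
        (s := l.toFinset) (t := W) (by omega)
      rw [List.mem_toFinset] at hvl
      have hcount : l.countP (fun u => ¬ G.Adj v u) ≤ g := by
        rw [List.countP_eq_length_filter, ← List.toFinset_card_of_nodup (hl.nodup.filter _)]
        refine le_trans (Finset.card_le_card ?_) (h v hvW)
        intro u hu
        simp only [List.mem_toFinset, List.mem_filter] at hu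
        simp only [Finset.mem_filter]
        exact ⟨hl' u hu.1, by simpa using hu.2⟩
      obtain ⟨l', h1, h2⟩ := hl.exists_insert hvl (by omega)
      refine ⟨l', h1, fun u hu => ?_⟩
      rcases h2 u hu with rfl | h3
      · exact hvW
      · exact hl' u h3
  exact key _ (by omega) le_rfl

/-- A nearly complete set contains disjoint paths with prescribed starts, numbers of vertices
and (for some of them) ends, up to using all of its vertices, provided that one of the paths
is to be long. All other paths are chosen greedily, the long one is a Hamiltonian path of what
is left. -/
lemma NearlyComplete.exists_disjoint_paths {T : Finset V} {g : ℕ} (h : NearlyComplete G T g)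
    {ι : Type*} [DecidableEq ι] (J : Finset ι) (σ : ι → V) (τ : ι → Option V) (n : ι → ℕ)
    (hσT : ∀ i ∈ J, σ i ∈ T) (hσ : Set.InjOn σ J)
    (hτT : ∀ i ∈ J, ∀ v ∈ τ i, v ∈ T ∧ 3 ≤ n i)
    (hστ : ∀ i ∈ J, ∀ j ∈ J, ∀ v ∈ τ i, σ j ≠ v)
    (hτ : ∀ i ∈ J, ∀ j ∈ J, ∀ v ∈ τ i, v ∈ τ j → i = j)
    (hn : ∀ i ∈ J, 1 ≤ n i) (hsum : ∑ i ∈ J, n i ≤ T.card)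
    {i₀ : ι} (hi₀ : i₀ ∈ J) (hlong : 4 * g + 2 * J.card + 5 ≤ n i₀) :
    ∃ l : ι → List V, (∀ i ∈ J, IsPathList G (l i) (σ i) (τ i) (n i) ∧ ∀ v ∈ l i, v ∈ T) ∧
      ∀ i ∈ J, ∀ j ∈ J, i ≠ j → (l i).Disjoint (l j) := by
  set R : Finset V := J.image σ ∪ J.biUnion (fun i => (τ i).toFinset) with hR
  have hRcard : R.card ≤ 2 * J.card := by
    have h1 := Finset.card_union_le (J.image σ) (J.biUnion (fun i => (τ i).toFinset))
    have h2 : (J.image σ).card ≤ J.card := Finset.card_image_le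
    have h3 : (J.biUnion (fun i => (τ i).toFinset)).card ≤ J.card * 1 :=
      Finset.card_biUnion_le_card_mul _ _ _ (fun i _ => by cases τ i <;> simp)
    rw [← hR] at h1
    omega
  have hσR : ∀ i ∈ J, σ i ∈ R := fun i hi =>
    Finset.mem_union_left _ (Finset.mem_image_of_mem _ hi)
  have hτR : ∀ i ∈ J, ∀ v ∈ τ i, v ∈ R := fun i hi v hv =>
    Finset.mem_union_right _ (Finset.mem_biUnion.2 ⟨i, hi, by simpa using hv⟩)
  have hend : ∀ i ∈ J, ∀ j ∈ J, i ≠ j → ∀ v, (v = σ i ∨ τ i = some v) →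
      (v = σ j ∨ τ j = some v ∨ v ∉ R) → False := by
    intro i hi j hj hij v hv hv'
    rcases hv with rfl | hv
    · rcases hv' with h1 | h1 | h1
      · exact hij (hσ hi hj h1)
      · exact hστ j hj i hi _ h1 rfl
      · exact h1 (hσR i hi)
    · rcases hv' with rfl | h1 | h1
      · exact hστ i hi j hj _ hv rfl
      · exact hij (hτ i hi j hj v hv h1)
      · exact h1 (hτR i hi v hv)
  have key : ∀ J' : Finset ι, J' ⊆ J.erase i₀ → ∃ l : ι → List V,
      (∀ i ∈ J', IsPathList G (l i) (σ i) (τ i) (n i) ∧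
        ∀ v ∈ l i, v ∈ T ∧ (v = σ i ∨ τ i = some v ∨ v ∉ R)) ∧
      ∀ i ∈ J', ∀ j ∈ J', i ≠ j → (l i).Disjoint (l j) := by
    intro J'
    induction J' using Finset.induction_on with
    | empty => intro _; exact ⟨fun _ => [], by simp, by simp⟩
    | insert a J' ha ih =>
      intro hJ'
      obtain ⟨l, hl, hd⟩ := ih ((Finset.subset_insert _ _).trans hJ')
      have haJ : a ∈ J := Finset.mem_of_mem_erase (hJ' (Finset.mem_insert_self _ _))
      have hJ'J : ∀ i ∈ J', i ∈ J := fun i hi =>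
        Finset.mem_of_mem_erase (hJ' (Finset.mem_insert_of_mem hi))
      have hUcard : (J'.biUnion fun i => (l i).toFinset).card ≤ ∑ i ∈ J', n i := by
        refine Finset.card_biUnion_le.trans (Finset.sum_le_sum fun i hi => ?_)
        rw [← (hl i hi).1.length]
        exact List.toFinset_card_le _
      have hs : ∑ i ∈ insert a J', n i + n i₀ ≤ ∑ i ∈ J, n i := by
        rw [← Finset.sum_erase_add _ _ hi₀]
        exact Nat.add_le_add_right (Finset.sum_le_sum_of_subset hJ') _
      rw [Finset.sum_insert ha] at hs
      obtain ⟨p, hp, hp'⟩ := h.exists_path (hn a haJ) (hσT a haJ) (t := τ a)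
        (fun v hv => ⟨(hτT a haJ v hv).1, hστ a haJ a haJ v hv, (hτT a haJ v hv).2⟩)
        (F := R ∪ J'.biUnion fun i => (l i).toFinset) (by
          have := Finset.card_union_le R (J'.biUnion fun i => (l i).toFinset)
          omega)
      have hdis : ∀ j ∈ J', p.Disjoint (l j) := by
        intro j hj v hv hv'
        have hne : a ≠ j := fun e => ha (e ▸ hj)
        rcases (hp' v hv).2 with h1 | h1 | h1
        · exact hend a haJ j (hJ'J j hj) hne v (Or.inl h1) ((hl j hj).2 v hv').2
        · exact hend a haJ j (hJ'J j hj) hne v (Or.inr h1) ((hl j hj).2 v hv').2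
        · exact h1 (Finset.mem_union_right _ (Finset.mem_biUnion.2 ⟨j, hj, by simpa using hv'⟩))
      have hne : ∀ j ∈ J', j ≠ a := fun j hj e => ha (e ▸ hj)
      refine ⟨Function.update l a p, ?_, ?_⟩
      · intro i hi
        rcases Finset.mem_insert.1 hi with rfl | hi
        · rw [Function.update_self]
          refine ⟨hp, fun v hv => ⟨(hp' v hv).1, ?_⟩⟩
          have := (hp' v hv).2
          simp only [Finset.mem_union, not_or] at this
          tauto
        · rw [Function.update_of_ne (hne i hi)]
          exact hl i hi
      · intro i hi j hj hij
        rcases Finset.mem_insert.1 hi with hi' | hi' <;>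
          rcases Finset.mem_insert.1 hj with hj' | hj'
        · exact absurd (hi'.trans hj'.symm) hij
        · rw [hi', Function.update_self, Function.update_of_ne (hne j hj')]
          exact hdis j hj'
        · rw [hj', Function.update_self, Function.update_of_ne (hne i hi')]
          exact (hdis i hi').symm
        · rw [Function.update_of_ne (hne i hi'), Function.update_of_ne (hne j hj')]
          exact hd i hi' j hj' hij
  obtain ⟨l, hl, hd⟩ := key (J.erase i₀) subset_rfl
  set U := (J.erase i₀).biUnion fun i => (l i).toFinset with hU
  have hUcard : U.card ≤ ∑ i ∈ J.erase i₀, n i := by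
    refine Finset.card_biUnion_le.trans (Finset.sum_le_sum fun i hi => ?_)
    rw [← (hl i hi).1.length]
    exact List.toFinset_card_le _
  have hs := Finset.sum_erase_add J n hi₀
  have hTU : n i₀ ≤ (T \ U).card := by
    have := Finset.le_card_sdiff U T
    omega
  have hendU : ∀ v, (v = σ i₀ ∨ τ i₀ = some v) → v ∉ U := by
    intro v hv hvU
    obtain ⟨j, hj, hvj⟩ := Finset.mem_biUnion.1 hvU
    rw [List.mem_toFinset] at hvj
    exact hend i₀ hi₀ j (Finset.mem_of_mem_erase hj) (Finset.ne_of_mem_erase hj).symm v hv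
      ((hl j hj).2 v hvj).2
  obtain ⟨W, hW1, hW2, hWc⟩ := Finset.exists_subsuperset_card_eq
    (s := insert (σ i₀) (τ i₀).toFinset) (t := T \ U) (n := n i₀) (by
      intro v hv
      rw [Finset.mem_insert, Option.mem_toFinset] at hv
      refine Finset.mem_sdiff.2 ⟨?_, hendU v hv⟩
      rcases hv with rfl | hv
      · exact hσT i₀ hi₀
      · exact (hτT i₀ hi₀ v hv).1) (by
      refine (Finset.card_insert_le _ _).trans ?_
      have : (τ i₀).toFinset.card ≤ 1 := by cases τ i₀ <;> simp
      omega) hTU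
  obtain ⟨p, hp, hp'⟩ := (h.mono (hW2.trans Finset.sdiff_subset)).exists_hamiltonian_path
    (by omega) (s := σ i₀) (hW1 (Finset.mem_insert_self _ _)) (t := τ i₀)
    (fun v hv => ⟨hW1 (Finset.mem_insert_of_mem (by simpa using hv)), hστ i₀ hi₀ i₀ hi₀ v hv⟩)
  rw [hWc] at hp
  have hdis : ∀ j ∈ J, j ≠ i₀ → p.Disjoint (l j) := by
    intro j hj hji v hv hv'
    exact (Finset.mem_sdiff.1 (hW2 (hp' v hv))).2
      (Finset.mem_biUnion.2 ⟨j, Finset.mem_erase.2 ⟨hji, hj⟩, by simpa using hv'⟩)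
  refine ⟨Function.update l i₀ p, ?_, ?_⟩
  · intro i hi
    by_cases hii : i = i₀
    · subst hii
      rw [Function.update_self]
      exact ⟨hp, fun v hv => (Finset.mem_sdiff.1 (hW2 (hp' v hv))).1⟩
    · rw [Function.update_of_ne hii]
      have := hl i (Finset.mem_erase.2 ⟨hii, hi⟩)
      exact ⟨this.1, fun v hv => (this.2 v hv).1⟩
  · intro i hi j hj hij
    by_cases hii : i = i₀
    · subst hii
      rw [Function.update_self, Function.update_of_ne hij.symm]
      exact hdis j hj hij.symm
    · by_cases hjj : j = i₀
      · subst hjj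
        rw [Function.update_self, Function.update_of_ne hij]
        exact (hdis i hi hij).symm
      · rw [Function.update_of_ne hii, Function.update_of_ne hjj]
        exact hd i (Finset.mem_erase.2 ⟨hii, hi⟩) j (Finset.mem_erase.2 ⟨hjj, hj⟩) hij

end Dense

/-! ### Covering a nearly complete side by paths -/

/-- `S` consists of a nearly complete set `T` and at most `g` exceptional vertices, and every
vertex of `S` has at least `h` neighbours in `T`. -/
structure NearSide {V : Type*} [DecidableEq V] (G : SimpleGraph V) [DecidableRel G.Adj]
    (S T : Finset V) (g h : ℕ) : Prop where
  subset : T ⊆ S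
  exceptional : (S \ T).card ≤ g
  nearly : NearlyComplete G T g
  degree : ∀ v ∈ S, h ≤ (T.filter fun u => G.Adj v u).card

section Cover

variable {V : Type*} {G : SimpleGraph V}

/-- If a path ends where another one starts, and they are otherwise disjoint, their union is
a path. -/
lemma IsPathList.dropLast_append {l l' : List V} {s z : V} {t : Option V} {n m : ℕ}
    (h : IsPathList G l s (some z) n) (h' : IsPathList G l' z t m)
    (hd : l.dropLast.Disjoint l') : IsPathList G (l.dropLast ++ l') s t (n - 1 + m) := by
  have hl : l.dropLast ++ [z] = l := List.dropLast_append_getLast? z (h.last z rfl)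
  obtain ⟨l₂, rfl⟩ : ∃ l₂, l' = z :: l₂ := by
    have := h'.head
    cases l' with
    | nil => simp at this
    | cons a l₂ => simp at this; exact ⟨l₂, by rw [this]⟩
  refine ⟨?_, ?_, ?_, ?_, ?_⟩
  · rw [List.isChain_split, hl]
    exact ⟨h.chain, h'.chain⟩
  · exact List.nodup_append.2 ⟨h.nodup.sublist (List.dropLast_sublist l), h'.nodup,
      fun x hx y hy hxy => hd hx (hxy ▸ hy)⟩
  · rw [List.length_append, List.length_dropLast, h.length, h'.length]
  · rw [← h.head]
    conv_rhs => rw [← hl]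
    cases l.dropLast <;> simp
  · intro v hv
    rw [List.getLast?_append, h'.last v hv]; rfl

variable [DecidableEq V] [DecidableRel G.Adj]

lemma NearSide.erase {S T : Finset V} {g h : ℕ} (H : NearSide G S T g (h + 1)) (x : V) :
    NearSide G (S.erase x) (T.erase x) g h where
  subset := Finset.erase_subset_erase _ H.subset
  exceptional := by
    refine (Finset.card_le_card ?_).trans H.exceptional
    intro v hv
    simp only [Finset.mem_sdiff, Finset.mem_erase] at hv ⊢
    tauto
  nearly := H.nearly.mono (Finset.erase_subset _ _)
  degree v hv := by
    have h1 := H.degree v (Finset.mem_of_mem_erase hv)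
    rw [Finset.filter_erase]
    have := Finset.pred_card_le_card_erase (s := T.filter fun u => G.Adj v u) (a := x)
    omega

lemma NearSide.le_card {S T : Finset V} {g h : ℕ} (H : NearSide G S T g h)
    (hS : S.Nonempty) : h ≤ S.card := by
  obtain ⟨v, hv⟩ := hS
  exact (H.degree v hv).trans
    (Finset.card_le_card ((Finset.filter_subset _ _).trans H.subset))

/-- A short path that collects all vertices of `E`, each of which has many neighbours in the
nearly complete set `T`, while avoiding `F`. -/
lemma NearlyComplete.exists_absorbing_path {T : Finset V} {g h : ℕ} (H : NearlyComplete G T g)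
    (E : Finset V) (hET : Disjoint E T) {F : Finset V} (hEF : Disjoint E F)
    (hE : ∀ e ∈ E, h ≤ (T.filter fun u => G.Adj e u).card)
    (hF : F.card + 4 * E.card + 2 * g + 3 ≤ h) {σ : V} (hσ : σ ∈ T) :
    ∃ l, ∃ z ∈ T, ∃ m ≤ 4 * E.card + 1, IsPathList G l σ (some z) m ∧ (∀ e ∈ E, e ∈ l) ∧
      ∀ v ∈ l, v = σ ∨ (v ∉ F ∧ (v ∈ T ∨ v ∈ E)) := by
  induction E using Finset.induction_on with
  | empty =>
    exact ⟨[σ], σ, hσ, 1, by simp, ⟨by simp, by simp, rfl, rfl, by simp⟩, by simp, by simp⟩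
  | insert e E he ih =>
    rw [Finset.card_insert_of_notMem he] at hF ⊢
    obtain ⟨heT, hET'⟩ := Finset.disjoint_insert_left.1 hET
    obtain ⟨heF, hEF'⟩ := Finset.disjoint_insert_left.1 hEF
    obtain ⟨l, z, hz, m, hm, hl, hEl, hlF⟩ :=
      ih hET' hEF' (fun e' he' => hE e' (Finset.mem_insert_of_mem he')) (by omega)
    have hlc : l.toFinset.card ≤ m := hl.length ▸ List.toFinset_card_le l
    have hdeg := hE e (Finset.mem_insert_self _ _)
    have hTh : h ≤ T.card := hdeg.trans (Finset.card_le_card (Finset.filter_subset _ _))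
    have hFl := Finset.card_union_le F l.toFinset
    -- a neighbour of `e` off the path, a common neighbour with the end `z`, and a further
    -- neighbour of `e`, which becomes the new end
    obtain ⟨u, hu, hu'⟩ := Finset.exists_mem_notMem_of_card_lt_card
      (s := F ∪ l.toFinset) (t := T.filter fun u => G.Adj e u) (by omega)
    simp only [Finset.mem_filter, Finset.mem_union, List.mem_toFinset, not_or] at hu hu'
    obtain ⟨w, hwT, hw', hzw, huw⟩ := H.exists_common_adj hz hu.1 (F := F ∪ l.toFinset) (by omega)
    simp only [Finset.mem_union, List.mem_toFinset, not_or] at hw'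
    have hc1 := Finset.card_insert_le w (insert u (F ∪ l.toFinset))
    have hc2 := Finset.card_insert_le u (F ∪ l.toFinset)
    obtain ⟨y, hy, hy'⟩ := Finset.exists_mem_notMem_of_card_lt_card
      (s := insert w (insert u (F ∪ l.toFinset))) (t := T.filter fun u => G.Adj e u) (by omega)
    simp only [Finset.mem_filter, Finset.mem_insert, Finset.mem_union, List.mem_toFinset,
      not_or] at hy hy'
    have heq : ∀ v ∈ T, e ≠ v := fun v hv hev => heT (hev ▸ hv)
    have hel : e ∉ l := by
      intro hel
      rcases hlF e hel with h1 | ⟨-, h1 | h1⟩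
      · exact heq σ hσ h1
      · exact heT h1
      · exact he h1
    have hp := (((hl.concat hzw hw'.2).concat huw.symm (b := u) (by
      simp [hu'.2, huw.ne])).concat hu.2.symm (b := e) (by
      simp [hel, heq w hwT, heq u hu.1])).concat hy.2 (b := y) (by
      simp [hy'.2.2.2, hy'.1, hy'.2.1, (heq y hy.1).symm])
    refine ⟨_, y, hy.1, _, by omega, hp, ?_, ?_⟩
    · intro v hv
      rcases Finset.mem_insert.1 hv with rfl | hv
      · simp
      · simp [hEl v hv]
    · intro v hv
      simp only [List.append_assoc, List.mem_append, List.mem_singleton] at hv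
      by_cases hvl : v ∈ l
      · rcases hlF v hvl with h1 | ⟨h1, h2 | h2⟩
        · exact Or.inl h1
        · exact Or.inr ⟨h1, Or.inl h2⟩
        · exact Or.inr ⟨h1, Or.inr (Finset.mem_insert_of_mem h2)⟩
      · right
        rcases hv with h1 | rfl | rfl | rfl | rfl
        · exact absurd h1 hvl
        · exact ⟨hw'.1, Or.inl hwT⟩
        · exact ⟨hu'.1, Or.inl hu.1⟩
        · exact ⟨heF, Or.inr (Finset.mem_insert_self _ _)⟩
        · exact ⟨hy'.2.2.1, Or.inl hy.1⟩

/-- If the vertices of a small set `Z` have many neighbours in `T`, Hall's theorem yields distinct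
neighbours in `T \ Z` for them. -/
lemma exists_private_neighbours {T Z : Finset V} {h : ℕ}
    (hZ : ∀ z ∈ Z, h ≤ (T.filter fun u => G.Adj z u).card) (hh : 2 * Z.card ≤ h) :
    ∃ φ : V → V, Set.InjOn φ Z ∧ ∀ z ∈ Z, φ z ∈ T ∧ φ z ∉ Z ∧ G.Adj z (φ z) := by
  obtain ⟨f, hf, hf'⟩ := (Finset.all_card_le_biUnion_card_iff_exists_injective
    (fun z : Z => (T.filter fun u => G.Adj z u) \ Z)).1 (by
      intro s
      rcases s.eq_empty_or_nonempty with rfl | ⟨z, hz⟩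
      · simp
      · have h1 := Finset.card_le_card (Finset.subset_biUnion_of_mem
          (fun z : Z => (T.filter fun u => G.Adj z u) \ Z) hz)
        have h2 := Finset.le_card_sdiff Z (T.filter fun u => G.Adj z u)
        have h3 := hZ z z.2
        have h4 : s.card ≤ Z.card := by simpa using Finset.card_le_univ s
        omega)
  refine ⟨fun v => if hv : v ∈ Z then f ⟨v, hv⟩ else v, ?_, ?_⟩
  · intro a ha b hb hab
    simp only [Finset.mem_coe] at ha hb
    simp only [ha, hb, dif_pos] at hab
    simpa using hf hab
  · intro z hz
    have := hf' ⟨z, hz⟩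
    simp only [Finset.mem_sdiff, Finset.mem_filter] at this
    simp only [hz, dif_pos]
    tauto

/-- A side can be partitioned into paths with prescribed starts, numbers of vertices and (for
some of them) ends, when the numbers of vertices add up to the size of the side. One of the
paths is long; it first collects the exceptional vertices, which leaves a nearly complete set. -/
lemma NearSide.exists_disjoint_paths {S T : Finset V} {g h k : ℕ} (H : NearSide G S T g h)
    (hk : k * (10 * g + 10 * k + 50) ≤ h)
    {ι : Type*} [DecidableEq ι] (J : Finset ι) (hJ : J.card ≤ k)
    (s : ι → V) (τ : ι → Option V) (n : ι → ℕ)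
    (hsS : ∀ i ∈ J, s i ∈ S) (hs : Set.InjOn s J)
    (hτS : ∀ i ∈ J, ∀ v ∈ τ i, v ∈ S ∧ 5 ≤ n i)
    (hsτ : ∀ i ∈ J, ∀ j ∈ J, ∀ v ∈ τ i, s j ≠ v)
    (hτ : ∀ i ∈ J, ∀ j ∈ J, ∀ v ∈ τ i, v ∈ τ j → i = j)
    (hn : ∀ i ∈ J, 1 ≤ n i) (hsum : ∑ i ∈ J, n i = S.card) :
    ∃ l : ι → List V, (∀ i ∈ J, IsPathList G (l i) (s i) (τ i) (n i) ∧ ∀ v ∈ l i, v ∈ S) ∧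
      ∀ i ∈ J, ∀ j ∈ J, i ≠ j → (l i).Disjoint (l j) := by
  rcases J.eq_empty_or_nonempty with rfl | hJne
  · exact ⟨fun _ => [], by simp, by simp⟩
  obtain ⟨i₁, hi₁⟩ := hJne
  have hJpos : 0 < J.card := Finset.card_pos.2 ⟨i₁, hi₁⟩
  have hhS : h ≤ S.card := H.le_card ⟨s i₁, hsS i₁ hi₁⟩
  have hh : 10 * g + 10 * k + 50 ≤ h := le_trans (Nat.le_mul_of_pos_left _ (by omega)) hk
  obtain ⟨i₀, hi₀, hlong⟩ : ∃ i₀ ∈ J, 10 * g + 10 * k + 50 ≤ n i₀ := by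
    by_contra! hc
    have h1 : ∑ i ∈ J, n i < ∑ _i ∈ J, (10 * g + 10 * k + 50) :=
      Finset.sum_lt_sum_of_nonempty ⟨i₁, hi₁⟩ hc
    rw [Finset.sum_const, smul_eq_mul] at h1
    have h2 := Nat.mul_le_mul_right (10 * g + 10 * k + 50) hJ
    omega
  -- the ends of the paths, and a private neighbour in `T` for each of them
  set Z : Finset V := J.image s ∪ J.biUnion (fun i => (τ i).toFinset) with hZdef
  set c : ι → ℕ := fun i => (τ i).toFinset.card with hc
  have hc1 : ∀ i, c i ≤ 1 := fun i => by simp only [hc]; cases τ i <;> simp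
  have hZcard : Z.card ≤ ∑ i ∈ J, (1 + c i) := by
    refine (Finset.card_union_le _ _).trans ?_
    rw [Finset.sum_add_distrib]
    refine Nat.add_le_add ?_ Finset.card_biUnion_le
    simpa using Finset.card_image_le
  have hZ2 : Z.card ≤ 2 * k := by
    refine hZcard.trans ((Finset.sum_le_card_nsmul J _ 2 fun i _ => ?_).trans ?_)
    · have := hc1 i; omega
    · rw [smul_eq_mul]; omega
  have hsZ : ∀ i ∈ J, s i ∈ Z := fun i hi =>
    Finset.mem_union_left _ (Finset.mem_image_of_mem _ hi)
  have hτZ : ∀ i ∈ J, ∀ v ∈ τ i, v ∈ Z := fun i hi v hv =>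
    Finset.mem_union_right _ (Finset.mem_biUnion.2 ⟨i, hi, by simpa using hv⟩)
  have hZS : ∀ z ∈ Z, z ∈ S := by
    intro z hz
    rcases Finset.mem_union.1 hz with hz | hz
    · obtain ⟨i, hi, rfl⟩ := Finset.mem_image.1 hz
      exact hsS i hi
    · obtain ⟨i, hi, hz⟩ := Finset.mem_biUnion.1 hz
      exact (hτS i hi z (by simpa using hz)).1
  obtain ⟨φ, hφ, hφ'⟩ := exists_private_neighbours (G := G) (T := T) (Z := Z)
    (fun z hz => H.degree z (hZS z hz)) (by omega)
  -- the path that collects the exceptional vertices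
  have hE1 : ((S \ T) \ Z).card ≤ g := (Finset.card_le_card Finset.sdiff_subset).trans H.exceptional
  have hφZ : (Z.image φ).card ≤ Z.card := Finset.card_image_le
  obtain ⟨Q, z, hzT, m, hm, hQ, hEQ, hQF⟩ := H.nearly.exists_absorbing_path (h := h) ((S \ T) \ Z)
    (Finset.disjoint_of_subset_left Finset.sdiff_subset Finset.sdiff_disjoint)
    (F := Z ∪ Z.image φ) (by
      rw [Finset.disjoint_left]
      intro e he heF
      simp only [Finset.mem_sdiff] at he
      rcases Finset.mem_union.1 heF with h1 | h1
      · exact he.2 h1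
      · obtain ⟨y, hy, rfl⟩ := Finset.mem_image.1 h1
        exact he.1.2 (hφ' y hy).1)
    (fun e he => H.degree e (by simp only [Finset.mem_sdiff] at he; exact he.1.1)) (by
      have := Finset.card_union_le Z (Z.image φ)
      omega) (σ := φ (s i₀)) (hφ' _ (hsZ i₀ hi₀)).1
  have hQφ : ∀ y ∈ Z, φ y ∈ Q → y = s i₀ := by
    intro y hy hyQ
    rcases hQF _ hyQ with h1 | ⟨h1, -⟩
    · exact hφ hy (hsZ i₀ hi₀) h1
    · exact absurd (Finset.mem_union_right _ (Finset.mem_image_of_mem _ hy)) h1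
  have hQZ : ∀ v ∈ Q, v ∉ Z := by
    intro v hv hvZ
    rcases hQF v hv with rfl | ⟨h1, -⟩
    · exact (hφ' _ (hsZ i₀ hi₀)).2.1 hvZ
    · exact h1 (Finset.mem_union_left _ hvZ)
  have hQS : ∀ v ∈ Q, v ∈ S := by
    intro v hv
    rcases hQF v hv with rfl | ⟨-, h1 | h1⟩
    · exact H.subset (hφ' _ (hsZ i₀ hi₀)).1
    · exact H.subset h1
    · simp only [Finset.mem_sdiff] at h1; exact h1.1.1
  have hQz : Q.dropLast ++ [z] = Q := List.dropLast_append_getLast? z (hQ.last z rfl)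
  have hdQ : ∀ v ∈ Q.dropLast, v ∈ Q := fun v hv => List.mem_of_mem_dropLast hv
  have hzQ : z ∈ Q := by rw [← hQz]; simp
  have hzd : z ∉ Q.dropLast := by
    have := hQ.nodup
    rw [← hQz, List.nodup_append] at this
    exact fun hz => this.2.2 z hz z (by simp) rfl
  have hm1 : 1 ≤ m := by
    rw [← hQ.length]; exact List.length_pos_of_mem hzQ
  have hφd : ∀ y ∈ Z, y ≠ s i₀ → φ y ∈ T \ (Z ∪ Q.dropLast.toFinset) := by
    intro y hy hne
    simp only [Finset.mem_sdiff, Finset.mem_union, List.mem_toFinset, not_or]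
    exact ⟨(hφ' y hy).1, (hφ' y hy).2.1, fun h1 => hne (hQφ y hy (hdQ _ h1))⟩
  -- the remaining nearly complete set and the paths to be found there
  set T' := T \ (Z ∪ Q.dropLast.toFinset) with hT'
  have hcover : S ⊆ Z ∪ Q.dropLast.toFinset ∪ T' := by
    intro v hv
    simp only [hT', Finset.mem_union, Finset.mem_sdiff, List.mem_toFinset]
    by_cases hvZ : v ∈ Z
    · simp [hvZ]
    by_cases hvT : v ∈ T
    · by_cases hvd : v ∈ Q.dropLast <;> simp [hvZ, hvT, hvd]
    · have h1 := hEQ v (by simp [hv, hvT, hvZ])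
      rw [← hQz, List.mem_append, List.mem_singleton] at h1
      rcases h1 with h1 | rfl
      · simp [h1]
      · exact absurd hzT hvT
  have hcovercard : S.card ≤ Z.card + (m - 1) + T'.card := by
    have h1 := Finset.card_le_card hcover
    have h2 := Finset.card_union_le (Z ∪ Q.dropLast.toFinset) T'
    have h3 := Finset.card_union_le Z Q.dropLast.toFinset
    have h4 := List.toFinset_card_le Q.dropLast
    rw [List.length_dropLast, hQ.length] at h4
    omega
  set σ : ι → V := fun i => if i = i₀ then z else φ (s i) with hσdef
  set p : ι → ℕ := fun i => n i - 1 - c i - (if i = i₀ then m - 1 else 0) with hp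
  have hcn : ∀ i ∈ J, 2 ≤ n i → 1 + c i + (if i = i₀ then m - 1 else 0) + 1 ≤ n i := by
    intro i hi hi2
    have h1 := hc1 i
    by_cases hii : i = i₀
    · subst hii; simp only [if_true]; omega
    · simp only [hii, if_false]
      rcases ht : τ i with _ | t
      · have : c i = 0 := by simp [hc, ht]
        omega
      · have := (hτS i hi t ht).2
        omega
  have hcn' : ∀ i ∈ J, p i + (1 + c i) + (if i = i₀ then m - 1 else 0) = n i := by
    intro i hi
    have h0 := hn i hi
    by_cases h2 : 2 ≤ n i
    · have h1 := hcn i hi h2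
      simp only [hp]
      omega
    · have hii : i ≠ i₀ := by rintro rfl; omega
      have : c i = 0 := by
        rcases ht : τ i with _ | t
        · simp [hc, ht]
        · have := (hτS i hi t ht).2
          omega
      simp only [hp, hii, if_false]
      omega
  have hpsum : ∑ i ∈ J, p i ≤ T'.card := by
    have h1 := Finset.sum_congr rfl hcn'
    rw [Finset.sum_add_distrib, Finset.sum_add_distrib, Finset.sum_ite_eq' J i₀,
      if_pos hi₀, hsum] at h1
    omega
  have hJ2 : ∀ {i}, i ∈ J.filter (fun i => 2 ≤ n i) → i ∈ J ∧ 2 ≤ n i := fun hi => by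
    simpa using hi
  have hτ2 : ∀ {i}, i ∈ J → ∀ v ∈ (τ i).map φ, ∃ t ∈ τ i, φ t = v := by
    intro i _ v hv
    simpa [Option.mem_def] using hv
  have hφne : ∀ i ∈ J, ∀ j ∈ J, ∀ t ∈ τ i, φ (s j) ≠ φ t := by
    intro i hi j hj t ht hst
    exact hsτ i hi j hj t ht (hφ (hsZ j hj) (hτZ i hi t ht) hst)
  have hzφ : ∀ y ∈ Z, y ≠ s i₀ → z ≠ φ y := by
    intro y hy hne hzy
    exact hne (hQφ y hy (hzy ▸ hzQ))
  obtain ⟨l, hl, hld⟩ := (H.nearly.mono (T' := T') Finset.sdiff_subset).exists_disjoint_paths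
    (J.filter fun i => 2 ≤ n i) σ (fun i => (τ i).map φ) p
    (by
      intro i hi
      simp only [hσdef]
      split_ifs with hii
      · simp only [hT', Finset.mem_sdiff, Finset.mem_union, List.mem_toFinset, not_or]
        exact ⟨hzT, hQZ z hzQ, hzd⟩
      · exact hφd _ (hsZ i (hJ2 hi).1) fun h1 => hii (hs (hJ2 hi).1 hi₀ h1))
    (by
      intro i hi j hj hij
      have hi := (hJ2 hi).1
      have hj := (hJ2 hj).1
      simp only [hσdef] at hij
      split_ifs at hij with h1 h2 h2
      · exact h1.trans h2.symm
      · exact absurd hij (hzφ _ (hsZ j hj) fun h3 => h2 (hs hj hi₀ h3))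
      · exact absurd hij.symm (hzφ _ (hsZ i hi) fun h3 => h1 (hs hi hi₀ h3))
      · exact hs hi hj (hφ (hsZ i hi) (hsZ j hj) hij))
    (by
      intro i hi v hv
      have hi := (hJ2 hi).1
      obtain ⟨t, ht, rfl⟩ := hτ2 hi v hv
      refine ⟨hφd _ (hτZ i hi t ht) (hsτ i hi i₀ hi₀ t ht).symm, ?_⟩
      have h5 := (hτS i hi t ht).2
      have hci := hc1 i
      simp only [hp]
      by_cases hii : i = i₀
      · subst hii; simp only [if_true]; omega
      · simp only [hii, if_false]; omega)
    (by
      intro i hi j hj v hv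
      have hi := (hJ2 hi).1
      have hj := (hJ2 hj).1
      obtain ⟨t, ht, rfl⟩ := hτ2 hi v hv
      simp only [hσdef]
      split_ifs with h1
      · exact hzφ _ (hτZ i hi t ht) (hsτ i hi i₀ hi₀ t ht).symm
      · exact hφne i hi j hj t ht)
    (by
      intro i hi j hj v hv hv'
      have hi := (hJ2 hi).1
      have hj := (hJ2 hj).1
      obtain ⟨t, ht, rfl⟩ := hτ2 hi v hv
      obtain ⟨t', ht', he⟩ := hτ2 hj _ hv'
      have := hφ (hτZ j hj t' ht') (hτZ i hi t ht) he
      subst this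
      exact hτ i hi j hj t' ht ht')
    (by
      intro i hi
      have := hcn i (hJ2 hi).1 (hJ2 hi).2
      simp only [hp]
      omega)
    ((Finset.sum_le_sum_of_subset (Finset.filter_subset _ _)).trans hpsum)
    (i₀ := i₀) (by simp only [Finset.mem_filter]; exact ⟨hi₀, by omega⟩)
    (by
      have h1 : (J.filter fun i => 2 ≤ n i).card ≤ J.card :=
        Finset.card_le_card (Finset.filter_subset _ _)
      have := hc1 i₀
      simp only [hp, if_true]
      omega)
  -- prepend the collecting path to the long one
  set l' : ι → List V := fun i => if i = i₀ then Q.dropLast ++ l i else l i with hl'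
  have hlT' : ∀ i ∈ J, 2 ≤ n i → ∀ v ∈ l i, v ∈ T ∧ v ∉ Z ∧ v ∉ Q.dropLast := by
    intro i hi h2 v hv
    have := (hl i (by simp [hi, h2])).2 v hv
    simpa only [hT', Finset.mem_sdiff, Finset.mem_union, List.mem_toFinset, not_or] using this
  have hl'1 : ∀ i ∈ J, 2 ≤ n i →
      IsPathList G (l' i) (φ (s i)) ((τ i).map φ) (n i - 1 - c i) := by
    intro i hi h2
    have h3 := (hl i (by simp [hi, h2])).1
    have h4 := hcn i hi h2
    by_cases hii : i = i₀
    · subst hii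
      simp only [hl', if_true]
      simp only [hσdef, if_true] at h3
      convert hQ.dropLast_append h3 (fun v hv hv' => (hlT' i hi h2 v hv').2.2 hv) using 1
      simp only [hp, if_true] at h4 ⊢
      omega
    · simp only [hl', hii, if_false]
      simp only [hσdef, hp, hii, if_false] at h3
      exact h3
  have hl'2 : ∀ i ∈ J, 2 ≤ n i → ∀ v ∈ l' i, v ∈ S ∧ v ∉ Z := by
    intro i hi h2 v hv
    simp only [hl'] at hv
    split_ifs at hv with hii
    · rcases List.mem_append.1 hv with hv | hv
      · exact ⟨hQS v (hdQ v hv), hQZ v (hdQ v hv)⟩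
      · exact ⟨H.subset (hlT' i hi h2 v hv).1, (hlT' i hi h2 v hv).2.1⟩
    · exact ⟨H.subset (hlT' i hi h2 v hv).1, (hlT' i hi h2 v hv).2.1⟩
  have hl'3 : ∀ i ∈ J, 2 ≤ n i → ∀ j ∈ J, 2 ≤ n j → i ≠ j → (l' i).Disjoint (l' j) := by
    intro i hi hi2 j hj hj2 hij v hv hv'
    have hd := hld i (by simp [hi, hi2]) j (by simp [hj, hj2]) hij
    simp only [hl'] at hv hv'
    split_ifs at hv hv' with h1 h2 h2
    · exact hij (h1.trans h2.symm)
    · rcases List.mem_append.1 hv with hv | hv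
      · exact (hlT' j hj hj2 v hv').2.2 hv
      · exact hd hv hv'
    · rcases List.mem_append.1 hv' with hv' | hv'
      · exact (hlT' i hi hi2 v hv).2.2 hv'
      · exact hd hv hv'
    · exact hd hv hv'
  -- add the prescribed ends
  have key : ∀ i ∈ J, ∃ L, IsPathList G L (s i) (τ i) (n i) ∧
      ∀ v ∈ L, v = s i ∨ v ∈ τ i ∨ (2 ≤ n i ∧ v ∈ l' i) := by
    intro i hi
    by_cases h2 : 2 ≤ n i
    · have h3 := hl'1 i hi h2
      have hsl : s i ∉ l' i := fun h4 => (hl'2 i hi h2 _ h4).2 (hsZ i hi)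
      rcases ht : τ i with _ | t
      · have hci : c i = 0 := by simp [hc, ht]
        rw [ht, hci] at h3
        have h5 := h3.cons (hφ' _ (hsZ i hi)).2.2 hsl
        have h6 : n i - 1 - 0 + 1 = n i := by omega
        rw [h6] at h5
        refine ⟨_, h5, ?_⟩
        intro v hv
        rcases List.mem_cons.1 hv with rfl | hv
        · exact Or.inl rfl
        · exact Or.inr (Or.inr ⟨h2, hv⟩)
      · have hci : c i = 1 := by simp [hc, ht]
        have h5n := (hτS i hi t ht).2
        have htZ := hτZ i hi t ht
        rw [ht, hci] at h3
        have h5 := (h3.concat (hφ' t htZ).2.2.symm fun h4 => (hl'2 i hi h2 _ h4).2 htZ).cons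
          (hφ' _ (hsZ i hi)).2.2 (by simp [hsl, hsτ i hi i hi t ht])
        have h6 : n i - 1 - 1 + 1 + 1 = n i := by omega
        rw [h6] at h5
        refine ⟨_, h5, ?_⟩
        intro v hv
        simp only [List.mem_cons, List.mem_append, List.not_mem_nil, or_false] at hv
        rcases hv with rfl | hv | rfl
        · exact Or.inl rfl
        · exact Or.inr (Or.inr ⟨h2, hv⟩)
        · exact Or.inr (Or.inl rfl)
    · have h1 : n i = 1 := by have := hn i hi; omega
      have : τ i = none := by
        rcases ht : τ i with _ | t
        · rfl
        · have := (hτS i hi t ht).2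
          omega
      rw [h1, this]
      exact ⟨[s i], isPathList_singleton _, by simp⟩
  choose! L hL hL' using key
  refine ⟨L, fun i hi => ⟨hL i hi, fun v hv => ?_⟩, ?_⟩
  · rcases hL' i hi v hv with rfl | h1 | ⟨h2, h1⟩
    · exact hsS i hi
    · exact (hτS i hi v h1).1
    · exact (hl'2 i hi h2 v h1).1
  · intro i hi j hj hij v hv hv'
    rcases hL' i hi v hv with h1 | h1 | ⟨h2, h1⟩ <;>
      rcases hL' j hj v hv' with h1' | h1' | ⟨h2', h1'⟩
    · exact hij (hs hi hj (h1.symm.trans h1'))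
    · exact hsτ j hj i hi v h1' h1.symm
    · exact (hl'2 j hj h2' v h1').2 (h1 ▸ hsZ i hi)
    · exact hsτ i hi j hj v h1 h1'.symm
    · exact hij (hτ i hi j hj v h1 h1')
    · exact (hl'2 j hj h2' v h1').2 (hτZ i hi v h1)
    · exact (hl'2 i hi h2 v h1).2 (h1' ▸ hsZ j hj)
    · exact (hl'2 i hi h2 v h1).2 (hτZ j hj v h1')
    · exact hl'3 i hi h2 j hj h2' hij h1 h1'

end Cover

/-! ### Paths that change sides at most once -/

section Crossing

variable {V : Type*} [DecidableEq V] {G : SimpleGraph V} [DecidableRel G.Adj]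

/-- The pieces in one side `S` of a system of paths in which the path from `x i` crosses between
the two sides, along the edge from `p i` to `q i`, exactly if `i ∈ K`: it has `α i` vertices
before and `β i` vertices after the crossing. -/
lemma NearSide.exists_pieces {S T : Finset V} {g h k : ℕ} (H : NearSide G S T g h)
    (hk : k * (10 * g + 10 * k + 50) ≤ h)
    {ι : Type*} [Fintype ι] [DecidableEq ι] (hι : Fintype.card ι ≤ k)
    {x : ι → V} (hx : Function.Injective x) {K : Finset ι} {p q : ι → V} {α β : ι → ℕ}
    (hα : ∀ i, 1 ≤ α i) (hβ : ∀ i ∈ K, 1 ≤ β i)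
    (hpS : ∀ i ∈ K, x i ∈ S → p i ∈ S) (hqS : ∀ i ∈ K, x i ∉ S → q i ∈ S)
    (hpx : ∀ i ∈ K, (α i = 1 ∧ p i = x i) ∨ (5 ≤ α i ∧ ∀ j, p i ≠ x j))
    (hqx : ∀ i ∈ K, ∀ j, q i ≠ x j)
    (hp : Set.InjOn p K) (hq : Set.InjOn q K) (hpq : ∀ i ∈ K, ∀ j ∈ K, p i ≠ q j)
    (hsum : ∑ i with x i ∈ S, α i + ∑ i ∈ K with x i ∉ S, β i = S.card) :
    ∃ f : ι → List V,
      (∀ i, x i ∈ S → IsPathList G (f i) (x i) (if i ∈ K then some (p i) else none) (α i)) ∧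
      (∀ i ∈ K, x i ∉ S → IsPathList G (f i) (q i) none (β i)) ∧
      (∀ i, (x i ∈ S ∨ i ∈ K) → ∀ v ∈ f i, v ∈ S) ∧
      ∀ i j, (x i ∈ S ∨ i ∈ K) → (x j ∈ S ∨ j ∈ K) → i ≠ j → (f i).Disjoint (f j) := by
  set J : Finset ι := (Finset.univ.filter fun i => x i ∈ S) ∪ (K.filter fun i => x i ∉ S) with hJ
  have hJm : ∀ {i}, i ∈ J ↔ x i ∈ S ∨ i ∈ K := by
    intro i
    simp only [hJ, Finset.mem_union, Finset.mem_filter, Finset.mem_univ, true_and]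
    tauto
  have hτ' : ∀ {i}, ∀ v ∈ (if x i ∈ S ∧ i ∈ K ∧ 5 ≤ α i then some (p i) else none),
      x i ∈ S ∧ i ∈ K ∧ 5 ≤ α i ∧ v = p i := by
    intro i v hv
    split_ifs at hv with h1
    · exact ⟨h1.1, h1.2.1, h1.2.2, by simpa [eq_comm] using hv⟩
    · simp at hv
  have hpx' : ∀ i ∈ K, 5 ≤ α i → ∀ j, p i ≠ x j := by
    intro i hi h5
    rcases hpx i hi with h1 | h1
    · omega
    · exact h1.2
  obtain ⟨f, hf, hfd⟩ := H.exists_disjoint_paths hk J ((Finset.card_le_univ J).trans hι)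
    (fun i => if x i ∈ S then x i else q i)
    (fun i => if x i ∈ S ∧ i ∈ K ∧ 5 ≤ α i then some (p i) else none)
    (fun i => if x i ∈ S then α i else β i)
    (by
      intro i hi
      have := hJm.1 hi
      split_ifs with h1
      · exact h1
      · exact hqS i (by tauto) h1)
    (by
      intro i hi j hj hij
      have hi := hJm.1 hi
      have hj := hJm.1 hj
      simp only at hij
      split_ifs at hij with h1 h2 h2
      · exact hx hij
      · exact absurd hij.symm (hqx j (by tauto) i)
      · exact absurd hij (hqx i (by tauto) j)
      · exact hq (by simpa using (by tauto : i ∈ K)) (by simpa using (by tauto : j ∈ K)) hij)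
    (by
      intro i hi v hv
      obtain ⟨h1, h2, h3, rfl⟩ := hτ' v hv
      simp only [h1, if_true]
      exact ⟨hpS i h2 h1, h3⟩)
    (by
      intro i hi j hj v hv
      obtain ⟨h1, h2, h3, rfl⟩ := hτ' v hv
      have hj := hJm.1 hj
      split_ifs with h4
      · exact (hpx' i h2 h3 j).symm
      · exact (hpq i h2 j (by tauto)).symm)
    (by
      intro i hi j hj v hv hv'
      obtain ⟨h1, h2, h3, h4⟩ := hτ' v hv
      obtain ⟨h1', h2', h3', h4'⟩ := hτ' v hv'
      exact hp h2 h2' (h4.symm.trans h4'))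
    (by
      intro i hi
      have hi := hJm.1 hi
      split_ifs with h1
      · exact hα i
      · exact hβ i (by tauto))
    (by
      rw [hJ, Finset.sum_union, ← hsum]
      · congr 1
        · exact Finset.sum_congr rfl fun i hi => by
            simp only [Finset.mem_filter] at hi; simp [hi.2]
        · exact Finset.sum_congr rfl fun i hi => by
            simp only [Finset.mem_filter] at hi; simp [hi.2]
      · rw [Finset.disjoint_left]
        intro i hi hi'
        simp only [Finset.mem_filter] at hi hi'
        exact hi'.2 hi.2)
  refine ⟨f, ?_, ?_, fun i hi => (hf i (hJm.2 hi)).2,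
    fun i j hi hj => hfd i (hJm.2 hi) j (hJm.2 hj)⟩
  · intro i hi
    have h1 := (hf i (hJm.2 (Or.inl hi))).1
    simp only [hi, if_true, true_and] at h1
    by_cases hiK : i ∈ K
    · simp only [hiK, true_and, if_true] at h1 ⊢
      rcases hpx i hiK with h2 | h2
      · -- the piece consists of `x i` alone
        rw [h2.2]
        refine ⟨h1.chain, h1.nodup, h1.length, h1.head, ?_⟩
        intro v hv
        simp only [Option.mem_def, Option.some.injEq] at hv
        obtain ⟨a, ha⟩ := List.length_eq_one_iff.1 (h1.length.trans h2.1)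
        have := h1.head
        rw [ha] at this ⊢
        simpa [hv] using this
      · simpa only [h2.1, if_true] using h1
    · simpa only [hiK, false_and, if_false] using h1
  · intro i hiK hi
    have h1 := (hf i (hJm.2 (Or.inr hiK))).1
    simpa only [hi, if_false, false_and] using h1

/-- Two disjoint sides can be partitioned into paths from given vertices `x i`, where the path
from `x i` changes sides, along the edge from `p i` to `q i`, exactly if `i ∈ K`, and has `α i`
vertices before and `β i` vertices after the change. -/
lemma exists_paths_of_crossings {A B TA TB : Finset V} {g h k : ℕ} (HA : NearSide G A TA g h)
    (HB : NearSide G B TB g h) (hAB : Disjoint A B)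
    (hk : k * (10 * g + 10 * k + 50) ≤ h)
    {ι : Type*} [Fintype ι] [DecidableEq ι] (hι : Fintype.card ι ≤ k)
    {x : ι → V} (hx : Function.Injective x) (hxAB : ∀ i, x i ∈ A ∨ x i ∈ B)
    {K : Finset ι} {p q : ι → V} {α β : ι → ℕ}
    (hα : ∀ i, 1 ≤ α i) (hβ : ∀ i ∈ K, 1 ≤ β i)
    (hside : ∀ i ∈ K, (x i ∈ A ∧ p i ∈ A ∧ q i ∈ B) ∨ (x i ∈ B ∧ p i ∈ B ∧ q i ∈ A))
    (hadj : ∀ i ∈ K, G.Adj (p i) (q i))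
    (hpx : ∀ i ∈ K, (α i = 1 ∧ p i = x i) ∨ (5 ≤ α i ∧ ∀ j, p i ≠ x j))
    (hqx : ∀ i ∈ K, ∀ j, q i ≠ x j)
    (hp : Set.InjOn p K) (hq : Set.InjOn q K) (hpq : ∀ i ∈ K, ∀ j ∈ K, p i ≠ q j)
    (hsumA : ∑ i with x i ∈ A, α i + ∑ i ∈ K with x i ∉ A, β i = A.card)
    (hsumB : ∑ i with x i ∈ B, α i + ∑ i ∈ K with x i ∉ B, β i = B.card) :
    ∃ l : ι → List V,
      (∀ i, IsPathList G (l i) (x i) none (α i + if i ∈ K then β i else 0) ∧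
        ∀ v ∈ l i, v ∈ A ∪ B) ∧
      ∀ i j, i ≠ j → (l i).Disjoint (l j) := by
  have hA : ∀ {v}, v ∈ A → v ∉ B := fun hv => Finset.disjoint_left.1 hAB hv
  have hB : ∀ {v}, v ∈ B → v ∉ A := fun hv => Finset.disjoint_right.1 hAB hv
  obtain ⟨f, hf1, hf2, hf3, hf4⟩ := HA.exists_pieces hk hι hx hα hβ
    (fun i hi h1 => by
      rcases hside i hi with h2 | h2
      · exact h2.2.1
      · exact absurd h1 (hB h2.1))
    (fun i hi h1 => by
      rcases hside i hi with h2 | h2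
      · exact absurd h2.1 h1
      · exact h2.2.2) hpx hqx hp hq hpq hsumA
  obtain ⟨f', hf'1, hf'2, hf'3, hf'4⟩ := HB.exists_pieces hk hι hx hα hβ
    (fun i hi h1 => by
      rcases hside i hi with h2 | h2
      · exact absurd h1 (hA h2.1)
      · exact h2.2.1)
    (fun i hi h1 => by
      rcases hside i hi with h2 | h2
      · exact h2.2.2
      · exact absurd h2.1 h1) hpx hqx hp hq hpq hsumB
  have hdis : ∀ i j, (x i ∈ A ∨ i ∈ K) → (x j ∈ B ∨ j ∈ K) → (f i).Disjoint (f' j) :=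
    fun i j hi hj v hv hv' => hA (hf3 i hi v hv) (hf'3 j hj v hv')
  have key : ∀ i, ∃ L, (IsPathList G L (x i) none (α i + if i ∈ K then β i else 0)) ∧
      ∀ v ∈ L, ((x i ∈ A ∨ i ∈ K) ∧ v ∈ f i) ∨ ((x i ∈ B ∨ i ∈ K) ∧ v ∈ f' i) := by
    intro i
    by_cases hiK : i ∈ K
    · simp only [hiK, if_true, or_true, true_and]
      rcases hxAB i with hi | hi
      · have h1 := hf1 i hi
        simp only [hiK, if_true] at h1
        exact ⟨_, h1.append (hf'2 i hiK (hA hi)) (hadj i hiK)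
          (hdis i i (Or.inr hiK) (Or.inr hiK)), fun v hv => List.mem_append.1 hv⟩
      · have h1 := hf'1 i hi
        simp only [hiK, if_true] at h1
        exact ⟨_, h1.append (hf2 i hiK (hB hi)) (hadj i hiK)
          (hdis i i (Or.inr hiK) (Or.inr hiK)).symm, fun v hv => (List.mem_append.1 hv).symm⟩
    · simp only [hiK, if_false, or_false, add_zero]
      rcases hxAB i with hi | hi
      · have h1 := hf1 i hi
        simp only [hiK, if_false] at h1
        exact ⟨_, h1, fun v hv => Or.inl ⟨hi, hv⟩⟩
      · have h1 := hf'1 i hi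
        simp only [hiK, if_false] at h1
        exact ⟨_, h1, fun v hv => Or.inr ⟨hi, hv⟩⟩
  choose L hL hL' using key
  refine ⟨L, fun i => ⟨hL i, fun v hv => ?_⟩, ?_⟩
  · rcases hL' i v hv with ⟨h1, h2⟩ | ⟨h1, h2⟩
    · exact Finset.mem_union_left _ (hf3 i h1 v h2)
    · exact Finset.mem_union_right _ (hf'3 i h1 v h2)
  · intro i j hij v hv hv'
    rcases hL' i v hv with ⟨h1, h2⟩ | ⟨h1, h2⟩ <;> rcases hL' j v hv' with ⟨h3, h4⟩ | ⟨h3, h4⟩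
    · exact hf4 i j h1 h3 hij h2 h4
    · exact hdis i j h1 h3 h2 h4
    · exact hdis j i h3 h1 h4 h2
    · exact hf'4 i j h1 h3 hij h2 h4

end Crossing

/-! ### Distributing the paths over the two sides -/

section Distribute

/-- A positive number that is at most a sum is reached by some of the summands and a part of
one more. -/
lemma Finset.exists_partial_sum {ι : Type*} [DecidableEq ι] (f : ι → ℕ) (Q : Finset ι) {e : ℕ}
    (h0 : 1 ≤ e) (he : e ≤ ∑ i ∈ Q, f i) :
    ∃ F ⊆ Q, ∃ j ∈ Q, j ∉ F ∧ ∑ i ∈ F, f i < e ∧ e ≤ ∑ i ∈ F, f i + f j := by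
  induction Q using Finset.induction_on with
  | empty => simp at he; omega
  | insert a Q ha ih =>
    rw [Finset.sum_insert ha] at he
    by_cases h : e ≤ ∑ i ∈ Q, f i
    · obtain ⟨F, hF, j, hj, h1⟩ := ih h
      exact ⟨F, hF.trans (Finset.subset_insert _ _), j, Finset.mem_insert_of_mem hj, h1⟩
    · exact ⟨Q, Finset.subset_insert _ _, a, Finset.mem_insert_self _ _, ha, by omega, by omega⟩

/-- Given more disjoint edges `a j`, `b j` than vertices `x i`, and a set `Q` of indices such that
no `b j` is an `x i` with `i ∈ Q`, there are distinct edges for the elements of `Q` and one extra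
edge such that all these edges avoid the vertices `x i`, except that the edge of `i` may
have `a`-end `x i`. -/
lemma exists_edge_assignment {V ι κ : Type*} [Fintype ι] [Fintype κ] [DecidableEq ι]
    (hcard : Fintype.card κ = Fintype.card ι + 1) {a b : κ → V} (ha : Function.Injective a)
    (hb : Function.Injective b) (hab : ∀ j j', a j ≠ b j') {x : ι → V}
    (hx : Function.Injective x) (Q : Finset ι) (hQb : ∀ i ∈ Q, ∀ j, b j ≠ x i) :
    ∃ (E : ι → κ) (e : κ), Set.InjOn E Q ∧ (∀ i ∈ Q, E i ≠ e) ∧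
      (∀ i ∈ Q, ∀ i', b (E i) ≠ x i') ∧ (∀ i, b e ≠ x i) ∧ (∀ i, a e ≠ x i) ∧
      ∀ i ∈ Q, a (E i) = x i ∨ ∀ i', a (E i) ≠ x i' := by
  classical
  have : Nonempty κ := Fintype.card_pos_iff.1 (by omega)
  set good : Finset κ := Finset.univ.filter fun j => ∀ i, i ∉ Q → a j ≠ x i ∧ b j ≠ x i with hgood
  have hmem : ∀ {j}, j ∈ good ↔ ∀ i, i ∉ Q → a j ≠ x i ∧ b j ≠ x i := by
    intro j; simp [hgood]
  have hgoodcard : Q.card + 1 ≤ good.card := by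
    have h1 : ∀ i, (∃ j, a j = x i ∨ b j = x i) → ∃ j, a j = x i ∨ b j = x i := fun _ h => h
    choose! c hc using h1
    have h2 : (Finset.univ : Finset κ) ⊆ good ∪ Qᶜ.image c := by
      intro j _
      by_contra hj
      simp only [Finset.mem_union, not_or, hmem, Finset.mem_image, Finset.mem_compl] at hj
      obtain ⟨h3, h4⟩ := hj
      push Not at h3
      obtain ⟨i, hi, h5⟩ := h3
      have h6 : a j = x i ∨ b j = x i := by tauto
      refine h4 ⟨i, hi, ?_⟩
      rcases hc i ⟨j, h6⟩ with h7 | h7 <;> rcases h6 with h8 | h8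
      · exact ha (h7.trans h8.symm)
      · exact absurd (h7.trans h8.symm) (hab _ _)
      · exact absurd (h8.trans h7.symm) (hab _ _)
      · exact hb (h7.trans h8.symm)
    have h3 := Finset.card_le_card h2
    have h4 := Finset.card_union_le good (Qᶜ.image c)
    have h5 : (Qᶜ.image c).card ≤ Qᶜ.card := Finset.card_image_le
    rw [Finset.card_univ] at h3
    have h6 := Finset.card_add_card_compl Q
    omega
  -- an edge at some `x i` is given to `i`, the other elements get the remaining edges
  have h1 : ∀ o : Option Q, (∃ j, ∃ i : Q, o = some i ∧ j ∈ good ∧ a j = x i) →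
      ∃ j, ∃ i : Q, o = some i ∧ j ∈ good ∧ a j = x i := fun _ h => h
  choose! f hf using h1
  set s : Finset (Option Q) := Finset.univ.filter fun o =>
    ∃ j, ∃ i : Q, o = some i ∧ j ∈ good ∧ a j = x i with hs
  have hsm : ∀ {o}, o ∈ s ↔ ∃ j, ∃ i : Q, o = some i ∧ j ∈ good ∧ a j = x i := by
    intro o; simp only [hs, Finset.mem_filter, Finset.mem_univ, true_and]
  have hcardα : Fintype.card (Option Q) = Q.card + 1 := by simp
  obtain ⟨t, hst, htg, htc⟩ := Finset.exists_subsuperset_card_eq (s := s.image f) (t := good)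
    (n := Q.card + 1) (by
      intro j hj
      obtain ⟨o, ho, rfl⟩ := Finset.mem_image.1 hj
      obtain ⟨i, -, h2, -⟩ := hf o (hsm.1 ho)
      exact h2) (Finset.card_image_le.trans (by rw [← hcardα]; exact Finset.card_le_univ s))
    hgoodcard
  obtain ⟨φ, hφ⟩ := Finset.exists_equiv_extend_of_card_eq (hcardα.trans htc.symm) hst (by
    intro o ho o' ho' hoo
    obtain ⟨i, hi, -, h2⟩ := hf o (hsm.1 ho)
    obtain ⟨i', hi', -, h2'⟩ := hf o' (hsm.1 ho')
    rw [hi, hi', Subtype.ext (hx (h2.symm.trans ((congrArg a hoo).trans h2')))])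
  have hφinj : ∀ o o', (φ o : κ) = φ o' → o = o' := fun o o' h => φ.injective (Subtype.ext h)
  have hφgood : ∀ o, (φ o : κ) ∈ good := fun o => htg (φ o).2
  have hφb : ∀ o i, b (φ o) ≠ x i := by
    intro o i h
    by_cases hi : i ∈ Q
    · exact hQb i hi _ h
    · exact (hmem.1 (hφgood o) i hi).2 h
  have hφa : ∀ o i, a (φ o) = x i → ∃ hi : i ∈ Q, o = some ⟨i, hi⟩ := by
    intro o i h
    by_cases hi : i ∈ Q
    · refine ⟨hi, ?_⟩
      have h2 : ∃ j, ∃ i' : Q, (some ⟨i, hi⟩ : Option Q) = some i' ∧ j ∈ good ∧ a j = x i' :=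
        ⟨φ o, ⟨i, hi⟩, rfl, hφgood o, h⟩
      obtain ⟨i', h3, -, h4⟩ := hf _ h2
      apply hφinj
      rw [hφ _ (hsm.2 h2)]
      apply ha
      rw [h4, h]
      rw [← Option.some.inj h3]
    · exact absurd h (hmem.1 (hφgood o) i hi).1
  refine ⟨fun i => if hi : i ∈ Q then φ (some ⟨i, hi⟩) else φ none, φ none, ?_, ?_, ?_, hφb none,
    ?_, ?_⟩
  · intro i hi i' hi' h
    simp only [Finset.mem_coe] at hi hi'
    simp only [hi, hi', dif_pos] at h
    simpa using hφinj _ _ h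
  · intro i hi h
    simp only [hi, dif_pos] at h
    simpa using hφinj _ _ h
  · intro i hi i'
    simp only [hi, dif_pos]
    exact hφb _ _
  · intro i h
    obtain ⟨_, h1⟩ := hφa _ _ h
    simp at h1
  · intro i hi
    simp only [hi, dif_pos]
    by_contra! hc
    obtain ⟨h1, i', h2⟩ := hc
    obtain ⟨h3, h4⟩ := hφa _ _ h2
    simp only [Option.some.injEq, Subtype.mk.injEq] at h4
    subst h4
    exact h1 h2

variable {V : Type*} [DecidableEq V] {G : SimpleGraph V} [DecidableRel G.Adj]

lemma NearSide.weaken {S T : Finset V} {g h : ℕ} (H : NearSide G S T g (h + 1)) :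
    NearSide G S T g h :=
  ⟨H.subset, H.exceptional, H.nearly, fun v hv => (Nat.le_succ h).trans (H.degree v hv)⟩

/-- Two disjoint sides joined by more disjoint edges than there are paths can be partitioned into
paths with prescribed starts and numbers of vertices. Here the paths starting in `A` have at
least `#A` vertices in total, so that some of them have to move to `B`. -/
lemma exists_paths_of_card_le {A B TA TB : Finset V} {g h : ℕ} {ι κ : Type*} [Fintype ι]
    [Fintype κ] [DecidableEq ι] (HA : NearSide G A TA g (h + 1)) (HB : NearSide G B TB g (h + 1))
    (hAB : Disjoint A B)
    (hk : Fintype.card ι * (10 * g + 10 * Fintype.card ι + 50) ≤ h)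
    (hcard : Fintype.card κ = Fintype.card ι + 1) {a b : κ → V} (ha : Function.Injective a)
    (hb : Function.Injective b) (haA : ∀ j, a j ∈ A) (hbB : ∀ j, b j ∈ B)
    (hab : ∀ j, G.Adj (a j) (b j))
    {x : ι → V} (hx : Function.Injective x) (hxAB : ∀ i, x i ∈ A ∨ x i ∈ B)
    {n : ι → ℕ} (hn : ∀ i, 1 ≤ n i) (hsum : ∑ i, n i = A.card + B.card)
    (hle : A.card ≤ ∑ i with x i ∈ A, n i) :
    ∃ l : ι → List V, (∀ i, IsPathList G (l i) (x i) none (n i)) ∧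
      ∀ i j, i ≠ j → (l i).Disjoint (l j) := by
  have hA : ∀ {v}, v ∈ A → v ∉ B := fun hv => Finset.disjoint_left.1 hAB hv
  have hB : ∀ {v}, v ∈ B → v ∉ A := fun hv => Finset.disjoint_right.1 hAB hv
  have hxB : ∀ i, x i ∈ B ↔ x i ∉ A := fun i => ⟨hB, fun h1 => (hxAB i).resolve_left h1⟩
  have hsplit : ∑ i with x i ∈ A, n i + ∑ i with x i ∈ B, n i = A.card + B.card := by
    rw [← hsum, ← Finset.sum_filter_add_sum_filter_not Finset.univ (fun i => x i ∈ A)]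
    simp only [hxB]
  have hab' : ∀ j j', a j ≠ b j' := fun j j' h1 => hA (haA j) (h1 ▸ hbB j')
  rcases hle.eq_or_lt with heq | hlt
  · -- every path stays on its side
    obtain ⟨l, hl, hl'⟩ := exists_paths_of_crossings HA.weaken HB.weaken hAB hk le_rfl hx hxAB
      (K := ∅) (p := x) (q := x) (α := n) (β := n) hn (by simp) (by simp) (by simp) (by simp)
      (by simp) (by simp) (by simp) (by simp) (by simp [heq]) (by simp; omega)
    exact ⟨l, fun i => by simpa using (hl i).1, hl'⟩
  obtain ⟨e, he⟩ := Nat.exists_eq_add_of_lt hlt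
  have : Nonempty κ := Fintype.card_pos_iff.1 (by omega)
  have hAcard : 9 * Fintype.card ι ≤ A.card := by
    refine le_trans ?_ (HA.weaken.le_card ⟨_, haA (Classical.arbitrary κ)⟩)
    refine le_trans ?_ hk
    rw [mul_comm]
    exact Nat.mul_le_mul_left _ (by omega)
  set Q : Finset ι := Finset.univ.filter fun i => x i ∈ A ∧ 10 ≤ n i with hQ
  have hQm : ∀ {i}, i ∈ Q ↔ x i ∈ A ∧ 10 ≤ n i := by intro i; simp [hQ]
  obtain ⟨E, e₀, hE, hEe, hbE, hbe, hae, haE⟩ := exists_edge_assignment hcard ha hb hab' hx Q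
    (fun i hi j h1 => hA (hQm.1 hi).1 (h1 ▸ hbB j))
  -- the largest number of vertices beyond the crossing edge of `i`, if `x i` is on that edge, and
  -- else what leaves room for a path from `x i` to the edge
  set full : ι → ℕ := fun i => if a (E i) = x i then n i - 1 else n i - 5 with hfull
  have hfullsum : e + 1 ≤ ∑ i ∈ Q, full i := by
    have h1 : ∑ i with x i ∈ A, n i ≤ ∑ i, ((if i ∈ Q then full i else 0) + 9) := by
      refine (Finset.sum_le_sum fun i hi => ?_).trans
        (Finset.sum_le_sum_of_subset (Finset.filter_subset _ _))
      by_cases hiQ : i ∈ Q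
      · simp only [hiQ, if_true, hfull]
        split_ifs <;> omega
      · have h2 : x i ∈ A := by simpa using hi
        have h3 : ¬ 10 ≤ n i := fun h3 => hiQ (hQm.2 ⟨h2, h3⟩)
        simp only [hiQ, if_false]
        omega
    rw [Finset.sum_add_distrib, Finset.sum_ite_mem, Finset.univ_inter, Finset.sum_const,
      smul_eq_mul, Finset.card_univ] at h1
    omega
  obtain ⟨F, hFQ, j, hjQ, hjF, hlt', hle'⟩ := Finset.exists_partial_sum full Q (by omega) hfullsum
  obtain ⟨t, ht⟩ := Nat.exists_eq_add_of_lt hlt'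
  obtain ⟨hjA, hj10⟩ := hQm.1 hjQ
  have hfj : full j ≤ n j - 1 := by simp only [hfull]; split_ifs <;> omega
  have hfj' : a (E j) ≠ x j → full j = n j - 5 := fun h1 => by simp [hfull, h1]
  have hffull : ∀ i ∈ F, 1 ≤ full i ∧ full i < n i ∧
      ((n i - full i = 1 ∧ a (E i) = x i) ∨ (5 ≤ n i - full i ∧ ∀ i', a (E i) ≠ x i')) := by
    intro i hi
    have h1 := hQm.1 (hFQ hi)
    simp only [hfull]
    split_ifs with h2
    · exact ⟨by omega, by omega, Or.inl ⟨by omega, h2⟩⟩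
    · exact ⟨by omega, by omega, Or.inr ⟨by omega, (haE i (hFQ hi)).resolve_left h2⟩⟩
  set K := insert j F with hK
  have hKQ : ∀ i ∈ K, i ∈ Q := by
    intro i hi
    rcases Finset.mem_insert.1 hi with rfl | hi
    · exact hjQ
    · exact hFQ hi
  have hKA : ∀ i ∈ K, x i ∈ A := fun i hi => (hQm.1 (hKQ i hi)).1
  have hKj : ∀ i ∈ K, i ≠ j → i ∈ F := fun i hi hij => (Finset.mem_insert.1 hi).resolve_left hij
  have hjK : j ∈ K := Finset.mem_insert_self _ _
  -- the numbers of vertices after and before the crossing edge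
  set β : ι → ℕ := fun i => if i = j then t + 1 else full i with hβ
  set α : ι → ℕ := fun i => if i ∈ K then n i - β i else n i with hα
  have hβK : ∀ i ∈ K, 1 ≤ β i ∧ β i < n i := by
    intro i hi
    simp only [hβ]
    split_ifs with h1
    · subst h1; omega
    · have := hffull i (hKj i hi h1); omega
  have hβsum : ∑ i ∈ K, β i = e + 1 := by
    rw [hK, Finset.sum_insert hjF]
    have : ∑ i ∈ F, β i = ∑ i ∈ F, full i := Finset.sum_congr rfl fun i hi => by
      have : i ≠ j := fun h1 => hjF (h1 ▸ hi)
      simp [hβ, this]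
    rw [this]
    simp only [hβ, if_true]
    omega
  have hα1 : ∀ i, 1 ≤ α i := by
    intro i
    simp only [hα]
    split_ifs with h1
    · have := hβK i h1; omega
    · exact hn i
  have hαβ : ∀ i, α i + (if i ∈ K then β i else 0) = n i := by
    intro i
    simp only [hα]
    split_ifs with h1
    · have := hβK i h1; omega
    · rfl
  have hαA : ∑ i with x i ∈ A, α i = A.card := by
    have h1 : ∑ i with x i ∈ A, (α i + if i ∈ K then β i else 0) = ∑ i with x i ∈ A, n i :=
      Finset.sum_congr rfl fun i _ => hαβ i
    rw [Finset.sum_add_distrib, Finset.sum_ite_mem, Finset.inter_eq_right.2 (by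
      intro i hi; simpa using hKA i hi), hβsum] at h1
    omega
  have hαB : ∑ i with x i ∈ B, α i = ∑ i with x i ∈ B, n i := by
    refine Finset.sum_congr rfl fun i hi => ?_
    have h1 : x i ∈ B := by simpa using hi
    have h2 : i ∉ K := fun h2 => hB h1 (hKA i h2)
    simp [hα, h2]
  have hpF : ∀ i ∈ K, i ≠ j → (α i = 1 ∧ a (E i) = x i) ∨ (5 ≤ α i ∧ ∀ i', a (E i) ≠ x i') := by
    intro i hi hij
    have h1 := (hffull i (hKj i hi hij)).2.2
    simpa only [hα, hβ, hi, hij, if_true, if_false] using h1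
  have hαj : α j = n j - (t + 1) := by simp [hα, hβ, hjK]
  by_cases hgood : α j = 1 ∨ 5 ≤ α j
  · -- every path changes sides at most once; the path from `x j` uses the extra edge if it
    -- starts on its own edge but may not cross immediately
    have hα1x : α j = 1 → a (E j) = x j := by
      intro h1
      by_contra h2
      have := hfj' h2
      omega
    set c : ι → κ := fun i => if i = j ∧ 5 ≤ α j ∧ a (E j) = x j then e₀ else E i with hc
    have hcF : ∀ i, i ≠ j → c i = E i := fun i hi => by simp [hc, hi]
    have hcj : c j = e₀ ∨ c j = E j := by simp only [hc]; split_ifs <;> simp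
    have hcinj : ∀ i ∈ K, ∀ i' ∈ K, c i = c i' → i = i' := by
      intro i hi i' hi' h1
      by_cases h2 : i = j <;> by_cases h3 : i' = j
      · exact h2.trans h3.symm
      · rw [hcF i' h3, h2] at h1
        rcases hcj with h4 | h4
        · exact absurd (h1.symm.trans h4) (hEe i' (hKQ i' hi'))
        · rw [h4] at h1
          exact h2.trans (hE hjQ (hKQ i' hi') h1)
      · rw [hcF i h2, h3] at h1
        rcases hcj with h4 | h4
        · exact absurd (h1.trans h4) (hEe i (hKQ i hi))
        · rw [h4] at h1
          exact (hE (hKQ i hi) hjQ h1).trans h3.symm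
      · rw [hcF i h2, hcF i' h3] at h1
        exact hE (hKQ i hi) (hKQ i' hi') h1
    obtain ⟨l, hl, hl'⟩ := exists_paths_of_crossings HA.weaken HB.weaken hAB hk le_rfl hx hxAB
      (K := K) (p := fun i => a (c i)) (q := fun i => b (c i)) (α := α) (β := β) hα1
      (fun i hi => (hβK i hi).1) (fun i hi => Or.inl ⟨hKA i hi, haA _, hbB _⟩)
      (fun i _ => hab _)
      (by
        intro i hi
        by_cases hij : i = j
        · subst hij
          simp only [hc, true_and]
          split_ifs with h1
          · exact Or.inr ⟨h1.1, hae⟩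
          · rcases hgood with h2 | h2
            · exact Or.inl ⟨h2, hα1x h2⟩
            · exact Or.inr ⟨h2, (haE i (hKQ i hi)).resolve_left fun h3 => h1 ⟨h2, h3⟩⟩
        · simp only [hcF i hij]
          exact hpF i hi hij)
      (by
        intro i hi
        by_cases hij : i = j
        · subst hij
          rcases hcj with h1 | h1 <;> simp only [h1]
          · exact hbe
          · exact hbE i hjQ
        · simp only [hcF i hij]
          exact hbE i (hKQ i hi))
      (fun i hi i' hi' h1 => hcinj i hi i' hi' (ha h1))
      (fun i hi i' hi' h1 => hcinj i hi i' hi' (hb h1))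
      (fun i _ i' _ => hab' _ _)
      (by
        rw [hαA, Finset.filter_false_of_mem fun i hi => not_not.2 (hKA i hi)]
        simp)
      (by
        rw [hαB, Finset.filter_true_of_mem fun i hi => hA (hKA i hi), hβsum]
        omega)
    exact ⟨l, fun i => by rw [← hαβ i]; exact (hl i).1, hl'⟩
  · -- the path from `x j` crosses immediately and returns through the extra edge
    have hxj : a (E j) = x j := by
      by_contra h2
      have := hfj' h2
      omega
    have hαj1 := hα1 j
    have hxnej : ∀ i, i ≠ j → x i ≠ x j := fun i hi h1 => hi (hx h1)
    set x' : ι → V := Function.update x j (b (E j)) with hx'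
    have hx'j : x' j = b (E j) := Function.update_self _ _ _
    have hx'i : ∀ i, i ≠ j → x' i = x i := fun i hi => Function.update_of_ne hi _ _
    have hx'A : ∀ i, x' i ∈ A.erase (x j) ↔ x i ∈ A ∧ i ≠ j := by
      intro i
      by_cases hij : i = j
      · subst hij
        rw [hx'j]
        simp [hB (hbB _)]
      · rw [hx'i i hij]
        simp [hij, hxnej i hij]
    have hx'B : ∀ i, x' i ∈ B ↔ x i ∈ B ∨ i = j := by
      intro i
      by_cases hij : i = j
      · subst hij
        rw [hx'j]
        simp [hbB _]
      · rw [hx'i i hij]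
        simp [hij]
    have hx'ne : ∀ v, (∀ i, v ≠ x i) → v ≠ b (E j) → ∀ i, v ≠ x' i := by
      intro v hv hvb i
      by_cases hij : i = j
      · subst hij; rwa [hx'j]
      · rw [hx'i i hij]; exact hv i
    have haej : a e₀ ∈ A.erase (x j) := Finset.mem_erase.2 ⟨hae j, haA _⟩
    have hbb : ∀ i ∈ K, i ≠ j → b (E i) ≠ b (E j) := fun i hi hij h1 =>
      hij (hE (hKQ i hi) hjQ (hb h1))
    obtain ⟨l, hl, hl'⟩ := exists_paths_of_crossings (HA.erase (x j)) HB.weaken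
      (Finset.disjoint_of_subset_left (Finset.erase_subset _ _) hAB) hk le_rfl
      (x := x') (by
        intro i i' h1
        by_cases h2 : i = j <;> by_cases h3 : i' = j
        · exact h2.trans h3.symm
        · rw [h2, hx'j, hx'i i' h3] at h1
          exact absurd h1 (hbE j hjQ i')
        · rw [h3, hx'j, hx'i i h2] at h1
          exact absurd h1.symm (hbE j hjQ i)
        · rw [hx'i i h2, hx'i i' h3] at h1
          exact hx h1)
      (by
        intro i
        rw [hx'A, hx'B]
        have := hxAB i
        tauto)
      (K := K) (p := fun i => if i = j then b e₀ else a (E i))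
      (q := fun i => if i = j then a e₀ else b (E i))
      (α := fun i => if i = j then t + 1 else α i)
      (β := fun i => if i = j then α j - 1 else full i)
      (by
        intro i
        split_ifs
        · omega
        · exact hα1 i)
      (by
        intro i hi
        split_ifs with h1
        · omega
        · exact (hffull i (hKj i hi h1)).1)
      (by
        intro i hi
        by_cases hij : i = j
        · subst hij
          simp only [if_true, hx'B]
          exact Or.inr ⟨Or.inr trivial, hbB _, haej⟩
        · simp only [hij, if_false, hx'A]
          refine Or.inl ⟨⟨hKA i hi, hij⟩, Finset.mem_erase.2 ⟨fun h1 => hij ?_, haA _⟩, hbB _⟩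
          exact hE (hKQ i hi) hjQ (ha (h1.trans hxj.symm)))
      (by
        intro i hi
        by_cases hij : i = j
        · simp only [hij, if_true]; exact (hab _).symm
        · simp only [hij, if_false]; exact hab _)
      (by
        intro i hi
        by_cases hij : i = j
        · subst hij
          simp only [if_true]
          refine Or.inr ⟨by omega, hx'ne _ hbe fun h1 => hEe i hjQ (hb h1).symm⟩
        · simp only [hij, if_false, hx'i i hij]
          rcases hpF i hi hij with h1 | h1
          · exact Or.inl h1
          · exact Or.inr ⟨h1.1, hx'ne _ h1.2 (hab' _ _)⟩)
      (by
        intro i hi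
        by_cases hij : i = j
        · subst hij
          simp only [if_true]
          exact hx'ne _ hae (hab' _ _)
        · simp only [hij, if_false]
          exact hx'ne _ (hbE i (hKQ i hi)) (hbb i hi hij))
      (by
        intro i hi i' hi' h1
        simp only at h1
        split_ifs at h1 with h2 h3 h3
        · exact h2.trans h3.symm
        · exact absurd h1.symm (hab' _ _)
        · exact absurd h1 (hab' _ _)
        · exact hE (hKQ i hi) (hKQ i' hi') (ha h1))
      (by
        intro i hi i' hi' h1
        simp only at h1
        split_ifs at h1 with h2 h3 h3
        · exact h2.trans h3.symm
        · exact absurd h1 (hab' _ _)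
        · exact absurd h1.symm (hab' _ _)
        · exact hE (hKQ i hi) (hKQ i' hi') (hb h1))
      (by
        intro i hi i' hi'
        split_ifs with h1 h2 h2
        · exact (hab' _ _).symm
        · exact fun h3 => hEe i' (hKQ i' hi') (hb h3).symm
        · exact fun h3 => hEe i (hKQ i hi) (ha h3)
        · exact hab' _ _)
      (by
        have h1 : (Finset.univ.filter fun i => x' i ∈ A.erase (x j)) =
            (Finset.univ.filter fun i => x i ∈ A).erase j := by
          ext i; simp only [Finset.mem_filter, Finset.mem_univ, true_and, hx'A, Finset.mem_erase]
          tauto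
        have h2 : (K.filter fun i => x' i ∉ A.erase (x j)) = {j} := by
          ext i
          simp only [Finset.mem_filter, hx'A, Finset.mem_singleton]
          constructor
          · rintro ⟨h3, h4⟩
            by_contra h5
            exact h4 ⟨hKA i h3, h5⟩
          · rintro rfl
            exact ⟨hjK, by simp⟩
        rw [h1, h2, Finset.sum_singleton, Finset.card_erase_of_mem hjA]
        simp only [if_true]
        have h3 := Finset.sum_erase_add (Finset.univ.filter fun i => x i ∈ A) α (a := j)
          (by simpa using hjA)
        rw [Finset.sum_congr rfl (g := fun i => α i) fun i hi => by
          simp [Finset.ne_of_mem_erase hi]]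
        omega)
      (by
        have h1 : (Finset.univ.filter fun i => x' i ∈ B) =
            insert j (Finset.univ.filter fun i => x i ∈ B) := by
          ext i; simp only [Finset.mem_filter, Finset.mem_univ, true_and, hx'B, Finset.mem_insert]
          tauto
        have h2 : (K.filter fun i => x' i ∉ B) = F := by
          ext i
          simp only [Finset.mem_filter, hx'B, not_or]
          constructor
          · rintro ⟨h3, -, h5⟩
            exact hKj i h3 h5
          · intro h3
            exact ⟨Finset.mem_insert_of_mem h3, hA (hKA i (Finset.mem_insert_of_mem h3)),
              fun h4 => hjF (h4 ▸ h3)⟩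
        rw [h1, h2, Finset.sum_insert (by simpa using hA hjA)]
        simp only [if_true]
        rw [Finset.sum_congr rfl (g := fun i => α i) fun i hi => by
          have : i ≠ j := by
            rintro rfl
            exact hA hjA (by simpa using hi)
          simp [this], hαB,
          Finset.sum_congr rfl (g := fun i => full i) (s₁ := F) fun i hi => by
            have : i ≠ j := fun h4 => hjF (h4 ▸ hi)
            simp [this]]
        omega)
    have hxjl : ∀ i, x j ∉ l i := by
      intro i h1
      rcases Finset.mem_union.1 ((hl i).2 _ h1) with h2 | h2
      · simp at h2
      · exact hA hjA h2
    refine ⟨fun i => if i = j then x j :: l j else l i, ?_, ?_⟩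
    · intro i
      by_cases hij : i = j
      · subst hij
        have h1 := (hl i).1
        simp only [hx'j, if_true, hjK] at h1 ⊢
        have h2 := h1.cons (hxj ▸ hab (E i)) (hxjl i)
        have h3 : t + 1 + (α i - 1) + 1 = n i := by omega
        rwa [h3] at h2
      · have h1 := (hl i).1
        simp only [hij, if_false, hx'i i hij] at h1 ⊢
        convert h1 using 1
        rw [← hαβ i]
        simp [hβ, hij]
    · intro i i' hii
      by_cases h1 : i = j <;> by_cases h2 : i' = j
      · exact absurd (h1.trans h2.symm) hii
      · simp only [h1, h2, if_true, if_false]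
        exact List.disjoint_cons_left.2 ⟨hxjl i', hl' _ _ (h1 ▸ hii)⟩
      · simp only [h1, h2, if_true, if_false]
        exact List.disjoint_cons_right.2 ⟨hxjl i, hl' _ _ (h2 ▸ hii)⟩
      · simp only [h1, h2, if_false]
        exact hl' _ _ hii

/-- Two disjoint sides joined by more disjoint edges than there are paths can be partitioned into
paths with prescribed starts and numbers of vertices. -/
lemma exists_paths_of_matching {A B TA TB : Finset V} {g h : ℕ} {ι κ : Type*} [Fintype ι]
    [Fintype κ] [DecidableEq ι] (HA : NearSide G A TA g (h + 1)) (HB : NearSide G B TB g (h + 1))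
    (hAB : Disjoint A B)
    (hk : Fintype.card ι * (10 * g + 10 * Fintype.card ι + 50) ≤ h)
    (hcard : Fintype.card κ = Fintype.card ι + 1) {a b : κ → V} (ha : Function.Injective a)
    (hb : Function.Injective b) (haA : ∀ j, a j ∈ A) (hbB : ∀ j, b j ∈ B)
    (hab : ∀ j, G.Adj (a j) (b j))
    {x : ι → V} (hx : Function.Injective x) (hxAB : ∀ i, x i ∈ A ∨ x i ∈ B)
    {n : ι → ℕ} (hn : ∀ i, 1 ≤ n i) (hsum : ∑ i, n i = A.card + B.card) :
    ∃ l : ι → List V, (∀ i, IsPathList G (l i) (x i) none (n i)) ∧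
      ∀ i j, i ≠ j → (l i).Disjoint (l j) := by
  have hxB : ∀ i, x i ∈ B ↔ x i ∉ A := fun i =>
    ⟨fun h1 => Finset.disjoint_right.1 hAB h1, fun h1 => (hxAB i).resolve_left h1⟩
  have hsplit : ∑ i with x i ∈ A, n i + ∑ i with x i ∈ B, n i = A.card + B.card := by
    rw [← hsum, ← Finset.sum_filter_add_sum_filter_not Finset.univ (fun i => x i ∈ A)]
    simp only [hxB]
  by_cases hle : A.card ≤ ∑ i with x i ∈ A, n i
  · exact exists_paths_of_card_le HA HB hAB hk hcard ha hb haA hbB hab hx hxAB hn hsum hle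
  · exact exists_paths_of_card_le HB HA hAB.symm hk hcard hb ha hbB haA (fun j => (hab j).symm) hx
      (fun i => (hxAB i).symm) hn (hsum.trans (add_comm _ _)) (by omega)

end Distribute

/-! ### Disjoint edges between two sets -/

section Matching

variable {V : Type*} {G : SimpleGraph V}

/-- `m` disjoint edges of `G` between `X` and `Y`. -/
def HasMatchingBetween (G : SimpleGraph V) (X Y : Finset V) (m : ℕ) : Prop :=
  ∃ a b : Fin m → V, Function.Injective a ∧ Function.Injective b ∧ (∀ i, a i ∈ X) ∧
    (∀ i, b i ∈ Y) ∧ ∀ i, G.Adj (a i) (b i)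

lemma HasMatchingBetween.symm {X Y : Finset V} {m : ℕ} (h : HasMatchingBetween G X Y m) :
    HasMatchingBetween G Y X m := by
  obtain ⟨a, b, ha, hb, hX, hY, hab⟩ := h
  exact ⟨b, a, hb, ha, hY, hX, fun i => (hab i).symm⟩

variable [DecidableEq V] [DecidableRel G.Adj]

/-- If every vertex of `X` has a neighbour in `Y` and no vertex of `Y` has many neighbours
in `X`, a choice of neighbours has a large image. -/
lemma hasMatchingBetween_of_degree_le {X Y : Finset V} {m D : ℕ} (hX : D * m < X.card)
    (h1 : ∀ v ∈ X, ∃ u ∈ Y, G.Adj v u)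
    (h2 : ∀ u ∈ Y, (X.filter fun v => G.Adj u v).card ≤ D) :
    HasMatchingBetween G X Y (m + 1) := by
  choose! f hfY hf using h1
  have h3 : X.card ≤ D * (X.image f).card := by
    refine Finset.card_le_mul_card_image X D fun u hu => ?_
    obtain ⟨v, hv, rfl⟩ := Finset.mem_image.1 hu
    refine (Finset.card_le_card ?_).trans (h2 _ (hfY v hv))
    intro w hw
    simp only [Finset.mem_filter] at hw ⊢
    exact ⟨hw.1, hw.2 ▸ (hf w hw.1).symm⟩
  have h4 : m + 1 ≤ (X.image f).card := by
    by_contra h5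
    have := Nat.mul_le_mul_left D (show (X.image f).card ≤ m by omega)
    omega
  obtain ⟨t, ht, htc⟩ := Finset.exists_subset_card_eq h4
  have h5 : ∀ u ∈ t, ∃ v ∈ X, f v = u := fun u hu => Finset.mem_image.1 (ht hu)
  choose! c hcX hc using h5
  set φ := (Finset.equivFinOfCardEq htc).symm
  have hfc : ∀ i, f (c (φ i)) = φ i := fun i => hc _ (φ i).2
  refine ⟨fun i => c (φ i), fun i => φ i, ?_, ?_, fun i => hcX _ (φ i).2, ?_, ?_⟩
  · intro i j hij
    have := congrArg f hij
    simp only [hfc] at this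
    exact φ.injective (Subtype.ext this)
  · intro i j hij
    exact φ.injective (Subtype.ext hij)
  · intro i
    have := hfY _ (hcX _ (φ i).2)
    rwa [hfc] at this
  · intro i
    have := hf _ (hcX _ (φ i).2)
    rwa [hfc] at this

lemma HasMatchingBetween.extend {X Y : Finset V} {m : ℕ} {v : V} (hv : v ∈ X)
    (hd : m < (Y.filter fun u => G.Adj v u).card)
    (h : HasMatchingBetween G (X.erase v) Y m) : HasMatchingBetween G X Y (m + 1) := by
  obtain ⟨a, b, ha, hb, hX, hY, hab⟩ := h
  obtain ⟨u, hu, hu'⟩ := Finset.exists_mem_notMem_of_card_lt_card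
    (s := Finset.univ.image b) (t := Y.filter fun u => G.Adj v u)
    (lt_of_le_of_lt Finset.card_image_le (by simpa using hd))
  simp only [Finset.mem_filter] at hu
  refine ⟨Fin.cons v a, Fin.cons u b, ?_, ?_, ?_, ?_, ?_⟩
  · refine Fin.cons_injective_iff.2 ⟨?_, ha⟩
    rintro ⟨i, rfl⟩
    exact Finset.ne_of_mem_erase (hX i) rfl
  · refine Fin.cons_injective_iff.2 ⟨?_, hb⟩
    rintro ⟨i, rfl⟩
    exact hu' (Finset.mem_image_of_mem _ (Finset.mem_univ i))
  · intro i
    refine Fin.cases hv (fun i => ?_) i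
    exact Finset.mem_of_mem_erase (hX i)
  · intro i
    exact Fin.cases hu.1 hY i
  · intro i
    exact Fin.cases hu.2 hab i

/-- A degree sum condition for `m` disjoint edges between two large sets. -/
lemma hasMatchingBetween_of_degree_add (m : ℕ) : ∀ {X Y : Finset V}, m * m + 1 ≤ X.card →
    m * m + 1 ≤ Y.card →
    (∀ u ∈ X, ∀ v ∈ Y, ¬ G.Adj u v →
      m ≤ (Y.filter fun w => G.Adj u w).card + (X.filter fun w => G.Adj v w).card) →
    HasMatchingBetween G X Y m := by
  induction m with
  | zero =>
    intro X Y _ _ _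
    exact ⟨Fin.elim0, Fin.elim0, fun i => i.elim0, fun i => i.elim0, fun i => i.elim0,
      fun i => i.elim0, fun i => i.elim0⟩
  | succ m ih =>
    intro X Y hX hY h
    have hm : (m + 1) * (m + 1) = m * m + 2 * m + 1 := by ring
    -- a vertex with more than `m` neighbours on the other side can be matched last
    by_cases hXd : ∃ v ∈ X, m < (Y.filter fun u => G.Adj v u).card
    · obtain ⟨v, hv, hd⟩ := hXd
      refine HasMatchingBetween.extend hv hd (ih ?_ (by omega) ?_)
      · rw [Finset.card_erase_of_mem hv]; omega
      · intro u hu w hw huw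
        have h1 := h u (Finset.mem_of_mem_erase hu) w hw huw
        have h2 := Finset.pred_card_le_card_erase (s := X.filter fun y => G.Adj w y) (a := v)
        rw [← Finset.filter_erase] at h2
        omega
    by_cases hYd : ∃ v ∈ Y, m < (X.filter fun u => G.Adj v u).card
    · obtain ⟨v, hv, hd⟩ := hYd
      refine (HasMatchingBetween.extend hv hd (ih ?_ (by omega) ?_)).symm
      · rw [Finset.card_erase_of_mem hv]; omega
      · intro w hw u hu huw
        have h1 := h u hu w (Finset.mem_of_mem_erase hw) fun h3 => huw h3.symm
        have h2 := Finset.pred_card_le_card_erase (s := Y.filter fun y => G.Adj u y) (a := v)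
        rw [← Finset.filter_erase] at h2
        omega
    push Not at hXd hYd
    by_cases hX1 : ∀ v ∈ X, ∃ u ∈ Y, G.Adj v u
    · exact hasMatchingBetween_of_degree_le (D := m) (by omega) hX1 hYd
    · push Not at hX1
      obtain ⟨v, hv, hvY⟩ := hX1
      refine (hasMatchingBetween_of_degree_le (D := m) (by omega) (fun u hu => ?_) hXd).symm
      have h1 := h v hv u hu (hvY u hu)
      rw [Finset.filter_false_of_mem fun w hw => hvY w hw, Finset.card_empty] at h1
      obtain ⟨w, hw⟩ := Finset.card_pos.1 (show 0 < (X.filter fun w => G.Adj u w).card by omega)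
      exact ⟨w, (Finset.mem_filter.1 hw).1, (Finset.mem_filter.1 hw).2⟩

end Matching

/-! ### Graphs that split into two nearly complete parts -/

section Split

variable {V : Type*} {G : SimpleGraph V}

lemma IsPathList.exists_walk {l : List V} {s : V} {t : Option V} {n : ℕ}
    (h : IsPathList G l s t n) : ∃ (y : V) (P : G.Walk s y), P.IsPath ∧ P.support = l := by
  have hs : l.head h.ne_nil = s := by
    have := List.head?_eq_some_head h.ne_nil
    rw [h.head] at this
    exact (Option.some.inj this).symm
  refine ⟨_, (SimpleGraph.Walk.ofSupport l h.ne_nil h.chain).copy hs rfl, ?_, ?_⟩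
  · rw [SimpleGraph.Walk.isPath_def, SimpleGraph.Walk.support_copy,
      SimpleGraph.Walk.support_ofSupport]
    exact h.nodup
  · rw [SimpleGraph.Walk.support_copy, SimpleGraph.Walk.support_ofSupport]

lemma hasPrescribedPaths_of_isPathList {k : ℕ} {s : Fin k → ℕ} {x : Fin k → V}
    (l : Fin k → List V) (hl : ∀ i, IsPathList G (l i) (x i) none (s i))
    (hd : ∀ i j, i ≠ j → (l i).Disjoint (l j)) : HasPrescribedPaths G s x := by
  choose y P hP hPl using fun i => (hl i).exists_walk
  refine ⟨y, P, hP, fun i => by rw [hPl, (hl i).length], fun i j hij => ?_⟩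
  rw [hPl, hPl]
  exact hd i j hij

lemma le_degree_add_degree_of_le_sigmaTwo [Fintype V] [DecidableRel G.Adj]
    {m : ℕ} (h : (m : ℕ∞) ≤ sigmaTwo G) {u v : V}
    (huv : u ≠ v) (hadj : ¬ G.Adj u v) : m ≤ G.degree u + G.degree v := by
  have : (m : ℕ∞) ≤ ((G.degree u + G.degree v : ℕ) : ℕ∞) :=
    h.trans (iInf_le_of_le u (iInf_le_of_le v (iInf_le_of_le huv (iInf_le _ hadj))))
  exact_mod_cast this

lemma card_filter_adj_lt [DecidableRel G.Adj] {A : Finset V} {u : V} (hu : u ∈ A) :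
    (A.filter fun w => G.Adj u w).card < A.card :=
  Finset.card_lt_card (Finset.filter_ssubset.2 ⟨u, hu, G.irrefl⟩)

variable [Fintype V] [DecidableEq V] [DecidableRel G.Adj]

lemma degree_eq_card_filter_add (A : Finset V) (u : V) :
    G.degree u = (A.filter fun w => G.Adj u w).card + (Aᶜ.filter fun w => G.Adj u w).card := by
  rw [← SimpleGraph.card_neighborFinset_eq_degree, SimpleGraph.neighborFinset_eq_filter,
    ← Finset.card_union_of_disjoint, ← Finset.filter_union, Finset.union_compl]
  exact Finset.disjoint_filter_filter (disjoint_compl_right)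

lemma degree_le_card_filter_add (X Y : Finset V) (u : V) :
    G.degree u ≤ (X.filter fun w => G.Adj u w).card +
      (Y.filter fun w => G.Adj u w).card + ((X ∪ Y)ᶜ : Finset V).card := by
  rw [← SimpleGraph.card_neighborFinset_eq_degree]
  refine (Finset.card_le_card ?_).trans ((Finset.card_union_le
    ((X.filter fun w => G.Adj u w) ∪ (Y.filter fun w => G.Adj u w)) _).trans
    (Nat.add_le_add_right (Finset.card_union_le _ _) _))
  intro w hw
  rw [SimpleGraph.mem_neighborFinset] at hw
  simp only [Finset.mem_union, Finset.mem_filter, hw, and_true, Finset.mem_compl, not_or]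
  tauto

/-- If a subgraph `G'` of almost the same degrees has no edges between `X` and `Y`, and few
vertices lie outside, then a vertex of `X` has few neighbours in `Y`. -/
lemma degree_bounds_of_no_edges {G' : SimpleGraph V} [DecidableRel G'.Adj] (hle : G' ≤ G)
    {X Y : Finset V} (hXY : ∀ u ∈ X, ∀ v ∈ Y, ¬ G'.Adj u v) {θ : ℝ}
    (hrest : (((X ∪ Y)ᶜ : Finset V).card : ℝ) ≤ θ)
    (hdeg : ∀ v, (G.degree v : ℝ) - θ ≤ G'.degree v) {u : V} (hu : u ∈ X) :
    ((Y.filter fun w => G.Adj u w).card : ℝ) ≤ θ ∧ (G.degree u : ℝ) ≤ X.card + 2 * θ := by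
  have h1 : G'.degree u + (Y.filter fun w => G.Adj u w).card ≤ G.degree u := by
    rw [← SimpleGraph.card_neighborFinset_eq_degree, ← SimpleGraph.card_neighborFinset_eq_degree,
      ← Finset.card_union_of_disjoint]
    · refine Finset.card_le_card (Finset.union_subset ?_ ?_)
      · intro w hw
        rw [SimpleGraph.mem_neighborFinset] at hw ⊢
        exact hle hw
      · intro w hw
        rw [SimpleGraph.mem_neighborFinset]
        exact (Finset.mem_filter.1 hw).2
    · rw [Finset.disjoint_left]
      intro w hw hw'
      rw [SimpleGraph.mem_neighborFinset] at hw
      exact hXY u hu w (Finset.mem_filter.1 hw').1 hw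
  have h2 : G'.degree u ≤ X.card + ((X ∪ Y)ᶜ : Finset V).card := by
    rw [← SimpleGraph.card_neighborFinset_eq_degree]
    refine (Finset.card_le_card ?_).trans (Finset.card_union_le _ _)
    intro w hw
    rw [SimpleGraph.mem_neighborFinset] at hw
    have := fun h => hXY u hu w h hw
    simp only [Finset.mem_union, Finset.mem_compl, not_or]
    tauto
  have h1' : (G'.degree u : ℝ) + ((Y.filter fun w => G.Adj u w).card : ℝ) ≤ G.degree u := by
    exact_mod_cast h1
  have h2' : (G'.degree u : ℝ) ≤ X.card + (((X ∪ Y)ᶜ : Finset V).card : ℝ) := by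
    exact_mod_cast h2
  have h3 := hdeg u
  constructor <;> linarith

/-- In the situation of `degree_bounds_of_no_edges`, a condition on the degree sums of nonadjacent
vertices makes `X` nearly complete: a vertex of `X` has a non-neighbour in `Y`, whose degree is
not much larger than `#Y`. -/
lemma le_card_filter_adj_of_no_edges {G' : SimpleGraph V} [DecidableRel G'.Adj] (hle : G' ≤ G)
    {X Y : Finset V} (hdis : Disjoint X Y) (hXY : ∀ u ∈ X, ∀ v ∈ Y, ¬ G'.Adj u v) {θ : ℝ}
    (hrest : (((X ∪ Y)ᶜ : Finset V).card : ℝ) ≤ θ)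
    (hdeg : ∀ v, (G.degree v : ℝ) - θ ≤ G'.degree v) (hY : θ < Y.card)
    (hσ : ∀ u v, u ≠ v → ¬ G.Adj u v → Fintype.card V ≤ G.degree u + G.degree v)
    {u : V} (hu : u ∈ X) :
    (X.card : ℝ) - 4 * θ ≤ (X.filter fun w => G.Adj u w).card := by
  obtain ⟨h1, -⟩ := degree_bounds_of_no_edges hle hXY hrest hdeg hu
  obtain ⟨v, hv, hv'⟩ : ∃ v ∈ Y, ¬ G.Adj u v := by
    by_contra! hc
    rw [Finset.filter_true_of_mem hc] at h1
    linarith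
  have h2 := hσ u v (fun h => Finset.disjoint_left.1 hdis hu (h ▸ hv)) hv'
  have hYX : ∀ v ∈ Y, ∀ u ∈ X, ¬ G'.Adj v u := fun v hv u hu h => hXY u hu v hv h.symm
  obtain ⟨-, h3⟩ := degree_bounds_of_no_edges hle hYX (by rwa [Finset.union_comm]) hdeg hv
  have h4 := degree_le_card_filter_add (G := G) X Y u
  have h5 : X.card + Y.card ≤ Fintype.card V := by
    rw [← Finset.card_union_of_disjoint hdis]
    exact Finset.card_le_univ _
  have h2' : (X.card : ℝ) + Y.card ≤ G.degree u + G.degree v := by exact_mod_cast h5.trans h2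
  have h4' : (G.degree u : ℝ) ≤ (X.filter fun w => G.Adj u w).card +
      (Y.filter fun w => G.Adj u w).card + (((X ∪ Y)ᶜ : Finset V).card : ℝ) := by
    exact_mod_cast h4
  linarith

/-- The paths exist if `G` splits into two nearly complete sides that cover all vertices. The
degree sum condition supplies more disjoint edges between the sides than there are paths. -/
lemma hasPrescribedPaths_of_nearSide {k : ℕ} {A TA TB : Finset V} {g h : ℕ}
    (HA : NearSide G A TA g (h + 1)) (HB : NearSide G Aᶜ TB g (h + 1))
    (hA : A.Nonempty) (hB : Aᶜ.Nonempty) (hk1 : 1 ≤ k)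
    (hk : k * (10 * g + 10 * k + 50) ≤ h)
    (hσ : ∀ u v, u ≠ v → ¬ G.Adj u v → Fintype.card V + k - 1 ≤ G.degree u + G.degree v)
    {s : Fin k → ℕ} (hs : ∀ i, 0 < s i) (hsum : ∑ i, s i = Fintype.card V)
    {x : Fin k → V} (hx : Function.Injective x) : HasPrescribedPaths G s x := by
  have hcard : A.card + Aᶜ.card = Fintype.card V := Finset.card_add_card_compl A
  have hA1 := HA.le_card hA
  have hB1 := HB.le_card hB
  have hm : (k + 1) * (k + 1) + 1 ≤ h := by
    refine le_trans ?_ hk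
    have : k * 1 ≤ k * k := Nat.mul_le_mul_left _ hk1
    have h2 : k * (10 * g + 10 * k + 50) = 10 * (k * g) + 10 * (k * k) + 50 * k := by ring
    have h3 : (k + 1) * (k + 1) = k * k + 2 * k + 1 := by ring
    omega
  obtain ⟨a, b, ha, hb, haA, hbB, hab⟩ := hasMatchingBetween_of_degree_add (G := G) (k + 1)
    (X := A) (Y := Aᶜ) (by omega) (by omega) (by
      intro u hu v hv huv
      have h1 := hσ u v (fun h => Finset.mem_compl.1 hv (h ▸ hu)) huv
      have h2 := degree_eq_card_filter_add (G := G) A u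
      have h3 := degree_eq_card_filter_add (G := G) A v
      have h4 := card_filter_adj_lt (G := G) hu
      have h5 := card_filter_adj_lt (G := G) hv
      omega)
  obtain ⟨l, hl, hl'⟩ := exists_paths_of_matching HA HB disjoint_compl_right (ι := Fin k)
    (κ := Fin (k + 1)) (by simpa using hk) (by simp) ha hb haA hbB hab hx
    (fun i => by rw [Finset.mem_compl]; tauto) hs (hsum.trans hcard.symm)
  exact hasPrescribedPaths_of_isPathList l hl hl'

/-- The paths exist if some subgraph `G'` of almost the same degrees has no edges between two
nonempty sets that contain almost all vertices. -/
lemma hasPrescribedPaths_of_no_edges {k : ℕ} (hk : 1 ≤ k) {G' : SimpleGraph V}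
    [DecidableRel G'.Adj] (hle : G' ≤ G) {X Y : Finset V} (hX : X.Nonempty) (hY : Y.Nonempty)
    (hdis : Disjoint X Y) (hXY : ∀ u ∈ X, ∀ v ∈ Y, ¬ G'.Adj u v) {θ : ℝ} (hθ : 0 ≤ θ)
    (hrest : (((X ∪ Y)ᶜ : Finset V).card : ℝ) ≤ θ)
    (hdeg : ∀ v, (G.degree v : ℝ) - θ ≤ G'.degree v)
    (hθn : 1600 * (k : ℝ) ^ 2 * θ ≤ Fintype.card V)
    (hn : 2880 * k ^ 3 ≤ Fintype.card V)
    (hδ : ∀ v, (Fintype.card V : ℝ) ≤ 8 * k * G.degree v)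
    (hσ : ∀ u v, u ≠ v → ¬ G.Adj u v → Fintype.card V + k - 1 ≤ G.degree u + G.degree v)
    {s : Fin k → ℕ} (hs : ∀ i, 0 < s i) (hsum : ∑ i, s i = Fintype.card V)
    {x : Fin k → V} (hx : Function.Injective x) : HasPrescribedPaths G s x := by
  set n := Fintype.card V with hndef
  have hk' : (1 : ℝ) ≤ k := by exact_mod_cast hk
  have hYX : ∀ v ∈ Y, ∀ u ∈ X, ¬ G'.Adj v u := fun v hv u hu h => hXY u hu v hv h.symm
  have hrest' : (((Y ∪ X)ᶜ : Finset V).card : ℝ) ≤ θ := by rwa [Finset.union_comm]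
  have hσ' : ∀ u v, u ≠ v → ¬ G.Adj u v → n ≤ G.degree u + G.degree v :=
    fun u v h1 h2 => by have := hσ u v h1 h2; omega
  -- all degrees are at least `5 * q`, the errors `θ` at most `q / (40 * k)`, and the number of
  -- neighbours required in a side is at most `2 * q`
  set q : ℝ := n / (40 * k) with hq
  have hqn : (n : ℝ) = 40 * k * q := by rw [hq]; field_simp
  have hθq : 40 * (k : ℝ) * θ ≤ q := by
    rw [hq, le_div_iff₀ (by positivity)]
    nlinarith
  have hθq1 : 40 * θ ≤ q := by nlinarith
  have hqk : 72 * (k : ℝ) ^ 2 ≤ q := by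
    rw [hq, le_div_iff₀ (by positivity)]
    have : 2880 * (k : ℝ) ^ 3 ≤ n := by exact_mod_cast hn
    nlinarith
  have hδ' : ∀ v, 5 * q ≤ G.degree v := by
    intro v
    have h1 := hδ v
    rw [hqn] at h1
    by_contra hc
    nlinarith
  have hXc : 4 * q ≤ X.card := by
    obtain ⟨u, hu⟩ := hX
    have := (degree_bounds_of_no_edges hle hXY hrest hdeg hu).2
    have := hδ' u
    linarith
  have hYc : 4 * q ≤ Y.card := by
    obtain ⟨u, hu⟩ := hY
    have := (degree_bounds_of_no_edges hle hYX hrest' hdeg hu).2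
    have := hδ' u
    linarith
  have hq0 : 0 < q := by nlinarith
  have hXX : ∀ u ∈ X, (X.card : ℝ) - 4 * θ ≤ (X.filter fun w => G.Adj u w).card := fun u hu =>
    le_card_filter_adj_of_no_edges hle hdis hXY hrest hdeg (by linarith) hσ' hu
  have hYY : ∀ u ∈ Y, (Y.card : ℝ) - 4 * θ ≤ (Y.filter fun w => G.Adj u w).card := fun u hu =>
    le_card_filter_adj_of_no_edges hle hdis.symm hYX hrest' hdeg (by linarith) hσ' hu
  set g : ℕ := ⌈4 * θ⌉₊ with hg
  have hg1 : 4 * θ ≤ g := Nat.le_ceil _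
  have hg2 : (g : ℝ) < 4 * θ + 1 := Nat.ceil_lt_add_one (by linarith)
  set h : ℕ := k * (10 * g + 10 * k + 50) with hh
  have hhq : (h : ℝ) + 1 ≤ 2 * q := by
    have : (h : ℝ) = k * (10 * g + 10 * k + 50) := by rw [hh]; push_cast; ring
    rw [this]
    nlinarith
  have hnear : ∀ Z : Finset V, (∀ u ∈ Z, (Z.card : ℝ) - 4 * θ ≤
      (Z.filter fun w => G.Adj u w).card) → NearlyComplete G Z g := by
    intro Z hZ u hu
    have h1 := Finset.card_filter_add_card_filter_not (s := Z) (fun w => G.Adj u w)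
    have h1' : ((Z.filter fun w => G.Adj u w).card : ℝ) +
      ((Z.filter fun w => ¬ G.Adj u w).card : ℝ) = Z.card := by exact_mod_cast h1
    have h2 := hZ u hu
    have h3 : ((Z.filter fun w => ¬ G.Adj u w).card : ℝ) ≤ g := by linarith
    exact_mod_cast h3
  have hrestg : ((X ∪ Y)ᶜ : Finset V).card ≤ g := by
    have : (((X ∪ Y)ᶜ : Finset V).card : ℝ) ≤ g := by linarith
    exact_mod_cast this
  -- the vertices outside `X` and `Y` join a side in which they have many neighbours
  set A : Finset V := X ∪ ((X ∪ Y)ᶜ).filter fun v => h + 1 ≤ (X.filter fun w => G.Adj v w).card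
    with hAdef
  have hXA : X ⊆ A := Finset.subset_union_left
  have hYA : Y ⊆ Aᶜ := by
    intro v hv
    simp only [hAdef, Finset.mem_compl, Finset.mem_union, Finset.mem_filter, not_or, not_and]
    exact ⟨Finset.disjoint_right.1 hdis hv, fun h1 => absurd hv h1.2⟩
  have HA : NearSide G A X g (h + 1) := by
    refine ⟨hXA, (Finset.card_le_card ?_).trans hrestg, hnear X hXX, ?_⟩
    · intro v hv
      simp only [hAdef, Finset.mem_sdiff, Finset.mem_union, Finset.mem_filter] at hv
      tauto
    · intro v hv
      rcases Finset.mem_union.1 hv with hv | hv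
      · have h1 := hXX v hv
        have h2 : (h : ℝ) + 1 ≤ (X.filter fun w => G.Adj v w).card := by linarith
        exact_mod_cast h2
      · exact (Finset.mem_filter.1 hv).2
  have HB : NearSide G Aᶜ Y g (h + 1) := by
    refine ⟨hYA, (Finset.card_le_card ?_).trans hrestg, hnear Y hYY, ?_⟩
    · intro v hv
      simp only [hAdef, Finset.mem_sdiff, Finset.mem_compl, Finset.mem_union] at hv ⊢
      tauto
    · intro v hv
      by_cases hvY : v ∈ Y
      · have h1 := hYY v hvY
        have h2 : (h : ℝ) + 1 ≤ (Y.filter fun w => G.Adj v w).card := by linarith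
        exact_mod_cast h2
      · simp only [hAdef, Finset.mem_compl, Finset.mem_union, Finset.mem_filter] at hv
        have h1 : (X.filter fun w => G.Adj v w).card < h + 1 := by
          by_contra hc
          exact hv (by
            by_cases hvX : v ∈ X
            · exact Or.inl hvX
            · exact Or.inr ⟨by tauto, by omega⟩)
        have h2 := degree_le_card_filter_add (G := G) X Y v
        have h2' : (G.degree v : ℝ) ≤ (X.filter fun w => G.Adj v w).card +
            (Y.filter fun w => G.Adj v w).card + (((X ∪ Y)ᶜ : Finset V).card : ℝ) := by
          exact_mod_cast h2
        have h1' : ((X.filter fun w => G.Adj v w).card : ℝ) ≤ h + 1 := by exact_mod_cast h1.le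
        have h3 := hδ' v
        have h4 : (h : ℝ) + 1 ≤ (Y.filter fun w => G.Adj v w).card := by linarith
        exact_mod_cast h4
  exact hasPrescribedPaths_of_nearSide HA HB (hX.mono hXA) (hY.mono hYA) hk le_rfl hσ hs hsum hx

end Split

/-! ### Regularity partitions with a poorly connected reduced graph -/

section Regularity

variable {V : Type*} [Fintype V] [DecidableEq V] {G G' : SimpleGraph V} [DecidableRel G.Adj]
  [DecidableRel G'.Adj] {ε d : ℝ} {m M r L : ℕ} {V₀ : Finset V} {C : Fin r → Finset V}

/-- Clusters that are not adjacent in the reduced graph have density `0`, hence no edges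
between them. -/
lemma IsRegularityPartition.not_adj (H : IsRegularityPartition G G' ε d m M r L V₀ C)
    {i j : Fin r} (hij : i ≠ j) (hR : ¬ (reducedGraph G' d C).Adj i j) :
    ∀ u ∈ C i, ∀ v ∈ C j, ¬ G'.Adj u v := by
  have key : ∀ i j : Fin r, i < j → ¬ d < ((G'.edgeDensity (C i) (C j) : ℚ) : ℝ) →
      ∀ u ∈ C i, ∀ v ∈ C j, ¬ G'.Adj u v := by
    intro i j hij hd u hu v hv huv
    have h0 := (H.density i j hij).resolve_right hd
    rw [SimpleGraph.edgeDensity_def, div_eq_zero_iff] at h0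
    have hi : ((C i).card : ℚ) ≠ 0 := by
      exact_mod_cast (Finset.card_pos.2 ⟨u, hu⟩).ne'
    have hj : ((C j).card : ℚ) ≠ 0 := by
      exact_mod_cast (Finset.card_pos.2 ⟨v, hv⟩).ne'
    rcases h0 with h0 | h0
    · have h1 : (G'.interedges (C i) (C j)).card = 0 := by exact_mod_cast h0
      rw [Finset.card_eq_zero] at h1
      have h2 : (u, v) ∈ G'.interedges (C i) (C j) :=
        (SimpleGraph.mem_interedges_iff G').2 ⟨hu, hv, huv⟩
      rw [h1] at h2
      simp at h2
    · exact mul_ne_zero hi hj h0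
  rcases lt_or_gt_of_ne hij with h | h
  · exact key i j h fun hd => hR ⟨hij, hd⟩
  · intro u hu v hv huv
    refine key j i h (fun hd => hR ⟨hij, ?_⟩) v hv u hu huv.symm
    rwa [G'.edgeDensity_comm]

/-- A small cut of the reduced graph separates the vertices outside a small set into two nonempty
parts without edges of `G'` between them. -/
lemma IsRegularityPartition.exists_no_edges (H : IsRegularityPartition G G' ε d m M r L V₀ C)
    (hε : 0 < ε) (hε' : ε < 1 / 100) (hV : 0 < Fintype.card V)
    (hκ : vertexConnectivity (reducedGraph G' d C) ≤ 1 ∨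
      (vertexConnectivity (reducedGraph G' d C) : ℝ) ≤ ε * (r : ℝ)) :
    ∃ X Y : Finset V, X.Nonempty ∧ Y.Nonempty ∧ Disjoint X Y ∧
      (∀ u ∈ X, ∀ v ∈ Y, ¬ G'.Adj u v) ∧
      (((X ∪ Y)ᶜ : Finset V).card : ℝ) ≤ 2 * ε * Fintype.card V := by
  classical
  set n := Fintype.card V with hn
  have hn0 : (0 : ℝ) < n := by exact_mod_cast hV
  have hcardU : ∀ S : Finset (Fin r), (S.biUnion C).card = S.card * L := by
    intro S
    rw [Finset.card_biUnion fun i _ j _ hij => H.disjoint_clusters i j hij,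
      Finset.sum_congr rfl fun i _ => H.card_cluster i, Finset.sum_const, smul_eq_mul]
  -- there are many clusters, and they are nonempty
  have hcover : n ≤ V₀.card + r * L := by
    have h1 : (Finset.univ : Finset V) ⊆ V₀ ∪ Finset.univ.biUnion C := by
      intro v _
      rcases H.cover v with h | ⟨i, h⟩
      · exact Finset.mem_union_left _ h
      · exact Finset.mem_union_right _ (Finset.mem_biUnion.2 ⟨i, Finset.mem_univ i, h⟩)
    have h2 := (Finset.card_le_card h1).trans (Finset.card_union_le _ _)
    rw [hcardU, Finset.card_univ, Finset.card_univ, Fintype.card_fin] at h2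
    exact h2
  have hcover' : (n : ℝ) ≤ V₀.card + r * L := by exact_mod_cast hcover
  have hrL : (r : ℝ) * L ≤ n := by
    have h1 := Finset.card_le_univ ((Finset.univ : Finset (Fin r)).biUnion C)
    rw [hcardU, Finset.card_univ, Fintype.card_fin] at h1
    exact_mod_cast h1
  have hV₀ := H.card_garbage
  have hL := H.cluster_le
  have hεr : 1 - ε ≤ ε * r := by
    have h1 : (r : ℝ) * L ≤ r * (ε * n) := mul_le_mul_of_nonneg_left hL (Nat.cast_nonneg r)
    have h2 : (1 - ε) * n ≤ (ε * r) * n := by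
      rw [← hn] at hV₀
      nlinarith
    exact le_of_mul_le_mul_right h2 hn0
  have hr : (99 : ℝ) ≤ r := by
    by_contra! hc
    nlinarith
  have hLpos : 0 < L := by
    rcases Nat.eq_zero_or_pos L with h0 | h0
    · rw [h0] at hcover'
      simp only [Nat.cast_zero, mul_zero, add_zero] at hcover'
      rw [← hn] at hV₀
      nlinarith
    · exact h0
  obtain ⟨S, hSc, hS⟩ := Nat.sInf_mem (s := {c : ℕ | ∃ S : Finset (Fin r), S.card = c ∧
    (¬ ((reducedGraph G' d C).induce {v | v ∉ S}).Connected ∨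
      Fintype.card (Fin r) ≤ S.card + 1)}) ⟨_, Finset.univ, rfl, Or.inr (by simp)⟩
  have hSc' : S.card = vertexConnectivity (reducedGraph G' d C) := hSc
  rw [← hSc'] at hκ
  have hSr : S.card + 1 < r := by
    have : (S.card : ℝ) + 1 < r := by
      rcases hκ with h | h
      · have : (S.card : ℝ) ≤ 1 := by exact_mod_cast h
        linarith
      · nlinarith
    exact_mod_cast this
  have hSL : (S.card : ℝ) * L ≤ ε * n := by
    rcases hκ with h | h
    · have h1 : (S.card : ℝ) ≤ 1 := by exact_mod_cast h
      exact (mul_le_of_le_one_left (Nat.cast_nonneg L) h1).trans hL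
    · calc (S.card : ℝ) * L ≤ ε * r * L := mul_le_mul_of_nonneg_right h (Nat.cast_nonneg L)
        _ = ε * (r * L) := by ring
        _ ≤ ε * n := mul_le_mul_of_nonneg_left hrL hε.le
  have hS' := hS.resolve_right (by rw [Fintype.card_fin]; omega)
  obtain ⟨i₀, -, hi₀⟩ := Finset.exists_mem_notMem_of_card_lt_card (s := S)
    (t := (Finset.univ : Finset (Fin r))) (by rw [Finset.card_univ, Fintype.card_fin]; omega)
  rw [SimpleGraph.connected_iff, not_and_or] at hS'
  have hS'' := hS'.resolve_right (not_not.2 ⟨⟨i₀, hi₀⟩⟩)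
  simp only [SimpleGraph.Preconnected, not_forall] at hS''
  obtain ⟨⟨a, haS⟩, ⟨b, hbS⟩, hab⟩ := hS''
  set D : Finset (Fin r) := Finset.univ.filter fun i =>
    ∃ h : i ∉ S, ((reducedGraph G' d C).induce {v | v ∉ S}).Reachable ⟨a, haS⟩ ⟨i, h⟩ with hD
  have hDm : ∀ {i}, i ∈ D ↔ ∃ h : i ∉ S,
      ((reducedGraph G' d C).induce {v | v ∉ S}).Reachable ⟨a, haS⟩ ⟨i, h⟩ := by
    intro i; simp [hD]
  have hadj : ∀ i ∈ D, ∀ j, j ∉ S → j ∉ D → ¬ (reducedGraph G' d C).Adj i j := by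
    intro i hi j hjS hjD hij
    obtain ⟨hiS, hi⟩ := hDm.1 hi
    refine hjD (hDm.2 ⟨hjS, hi.trans (SimpleGraph.Adj.reachable ?_)⟩)
    exact hij
  have hCne : ∀ i, (C i).Nonempty := fun i =>
    Finset.card_pos.1 (by rw [H.card_cluster]; exact hLpos)
  have hEm : ∀ {j}, j ∈ Dᶜ \ S ↔ j ∉ D ∧ j ∉ S := by intro j; simp
  refine ⟨D.biUnion C, (Dᶜ \ S).biUnion C, ?_, ?_, ?_, ?_, ?_⟩
  · obtain ⟨v, hv⟩ := hCne a
    exact ⟨v, Finset.mem_biUnion.2 ⟨a, hDm.2 ⟨haS, SimpleGraph.Reachable.refl _⟩, hv⟩⟩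
  · obtain ⟨v, hv⟩ := hCne b
    refine ⟨v, Finset.mem_biUnion.2 ⟨b, hEm.2 ⟨fun h => ?_, hbS⟩, hv⟩⟩
    obtain ⟨_, h1⟩ := hDm.1 h
    exact hab h1
  · rw [Finset.disjoint_biUnion_left]
    intro i hi
    rw [Finset.disjoint_biUnion_right]
    intro j hj
    exact H.disjoint_clusters i j (by rintro rfl; exact (hEm.1 hj).1 hi)
  · intro u hu v hv
    obtain ⟨i, hi, hu⟩ := Finset.mem_biUnion.1 hu
    obtain ⟨j, hj, hv⟩ := Finset.mem_biUnion.1 hv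
    have hj := hEm.1 hj
    exact H.not_adj (by rintro rfl; exact hj.1 hi) (hadj i hi j hj.2 hj.1) u hu v hv
  · have h1 : ((D.biUnion C ∪ (Dᶜ \ S).biUnion C)ᶜ : Finset V) ⊆ V₀ ∪ S.biUnion C := by
      intro v hv
      simp only [Finset.mem_compl, Finset.mem_union, not_or, Finset.mem_biUnion, not_exists,
        not_and] at hv
      rcases H.cover v with h | ⟨i, h⟩
      · exact Finset.mem_union_left _ h
      · refine Finset.mem_union_right _ (Finset.mem_biUnion.2 ⟨i, ?_, h⟩)
        by_contra hiS
        exact hv.2 i (hEm.2 ⟨fun hiD => hv.1 i hiD h, hiS⟩) h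
    have h2 := (Finset.card_le_card h1).trans (Finset.card_union_le _ _)
    rw [hcardU] at h2
    have h3 : (((D.biUnion C ∪ (Dᶜ \ S).biUnion C)ᶜ : Finset V).card : ℝ) ≤
        V₀.card + S.card * L := by exact_mod_cast h2
    linarith

end Regularity

theorem lemma3p2 (k : ℕ) (hk : 1 ≤ k) :
    ∃ c : ℝ, 0 < c ∧ ∀ ε d : ℝ, 0 < ε → ε < c → 0 < d → d < c →
      ∃ n₀ : ℕ, ∀ (V : Type u) [Fintype V] [DecidableEq V]
        (G G' : SimpleGraph V) [DecidableRel G.Adj] [DecidableRel G'.Adj]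
        (s : Fin k → ℕ) (m M r L : ℕ) (V₀ : Finset V) (C : Fin r → Finset V),
        n₀ ≤ Fintype.card V →
        (∀ i, 0 < s i) →
        ∑ i, s i = Fintype.card V →
        ((Fintype.card V + k - 1 : ℕ) : ℕ∞) ≤ sigmaTwo G →
        (∀ i, (s i : ℝ) / 8 ≤ (G.minDegree : ℝ)) →
        IsRegularityPartition G G' ε d m M r L V₀ C →
        (vertexConnectivity (reducedGraph G' d C) ≤ 1 ∨
          (vertexConnectivity (reducedGraph G' d C) : ℝ) ≤ ε * (r : ℝ)) →
        ∀ x : Fin k → V, Function.Injective x → HasPrescribedPaths G s x := by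
  have hk' : (1 : ℝ) ≤ k := by exact_mod_cast hk
  refine ⟨1 / (6400 * (k : ℝ) ^ 2), by positivity, fun ε d hε hεc hd hdc => ⟨2880 * k ^ 3, ?_⟩⟩
  intro V _ _ G G' _ _ s m M r L V₀ C hn hs hsum hσ hδ H hκ x hx
  rw [lt_div_iff₀ (by positivity)] at hεc hdc
  have hε1 : ε < 1 / 100 := by nlinarith
  have hV : 0 < Fintype.card V := lt_of_lt_of_le (by positivity) hn
  have hn0 : (0 : ℝ) < Fintype.card V := by exact_mod_cast hV
  obtain ⟨X, Y, hX, hY, hdis, hXY, hrest⟩ := H.exists_no_edges hε hε1 hV hκ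
  refine hasPrescribedPaths_of_no_edges hk H.subgraph hX hY hdis hXY
    (θ := (d + 3 * ε) * Fintype.card V) (by positivity) (hrest.trans ?_) ?_ ?_ hn ?_
    (fun u v h1 h2 => le_degree_add_degree_of_le_sigmaTwo hσ h1 h2) hs hsum hx
  · exact mul_le_mul_of_nonneg_right (by linarith) hn0.le
  · intro v
    have h1 := H.degree_lt v
    have h2 : 0 < ε * (Fintype.card V : ℝ) := by positivity
    linarith
  · have h1 : 1600 * (k : ℝ) ^ 2 * (d + 3 * ε) ≤ 1 := by linarith
    have h2 := mul_le_mul_of_nonneg_right h1 hn0.le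
    rw [one_mul, mul_assoc] at h2
    exact h2
  · intro v
    have h1 : ∀ i, (s i : ℝ) ≤ 8 * G.degree v := fun i => by
      have h2 : (G.minDegree : ℝ) ≤ G.degree v := by exact_mod_cast G.minDegree_le_degree v
      have := hδ i
      linarith
    have h2 : (∑ i, (s i : ℝ)) ≤ ∑ _i : Fin k, 8 * (G.degree v : ℝ) :=
      Finset.sum_le_sum fun i _ => h1 i
    rw [Finset.sum_const, Finset.card_univ, Fintype.card_fin, nsmul_eq_mul] at h2
    have h3 : (∑ i, (s i : ℝ)) = Fintype.card V := by exact_mod_cast hsum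
    linarith
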